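/- Consider adaptive quantum algorithms consisting of (1) measurements of single qubits in the computational basis, where a measured qubit is discarded and all later operations may depend on the outcome, (2) single-qubit Clifford operations, and (3) two-qubit Clifford operations. Here an $n$-qubit Clifford operation is a unitary $U$ with $U\mathcal G_nU^\dagger=\mathcal G_n$, where $\mathcal G_n=\{\alpha\,h_1\otimes\dots\otimes h_n : \alpha\in\{\pm1,\pm i\},\ h_j\in\{I,X,Y,Z\}\}$ is the Pauli group. The CZ-complexity of such an algorithm is the maximum, over the measurement outcomes, of the number of two-qubit Clifford operations that it performs. For a graph $G$ with vertex set $\{1,\dots,n\}$, the graph state $|G\rangle$ is the $n$-qubit state (unique up to phase) that is stabilized by $X_v\otimes\bigotimes_{w\in N_G(v)}Z_w$ for all vertices $v$, where $N_G(v)$ is the set of neighbours of $v$. Its CZ-complexity $\Gamma_{\mathrm{CZ}}(|G\rangle)$ is the minimum CZ-complexity of an algorithm of this type that generates $|G\rangle$ from $|0\rangle^{\otimes(n+s)}$ with probability $1$ for some $s\ge 0$. **Theorem.** For every graph $G$ there are an $s\ge 0$ and an algorithm of this type that generates $|G\rangle$ from $|0\rangle^{\otimes(n+s)}$ with probability $1$,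 has CZ-complexity exactly $\Gamma_{\mathrm{CZ}}(|G\rangle)$, and in which all two-qubit Clifford operations are $\mathrm{CZ}=\mathrm{diag}(1,1,1,-1)$ gates. -/

import Mathlib

namespace QPrep

open scoped Matrix

noncomputable section

/-! ### Qubit registers, Pauli and Clifford operators -/

/-- Labels of the computational basis of an `n`-qubit register. -/
abbrev Bits (n : ℕ) : Type := Fin n → Fin 2

/-- Operators on `n` qubits, as matrices in the computational basis. -/
abbrev Op (n : ℕ) : Type := Matrix (Bits n) (Bits n) ℂ

/-- Vectors of `n` qubits, given by their amplitudes in the computational basis. -/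
abbrev State (n : ℕ) : Type := Bits n → ℂ

/-- The Pauli matrix `X`. -/
def pauliX : Matrix (Fin 2) (Fin 2) ℂ := !![0, 1; 1, 0]

/-- The Pauli matrix `Y`. -/
def pauliY : Matrix (Fin 2) (Fin 2) ℂ := !![0, -Complex.I; Complex.I, 0]

/-- The Pauli matrix `Z`. -/
def pauliZ : Matrix (Fin 2) (Fin 2) ℂ := !![1, 0; 0, -1]

/-- The tensor (Kronecker) product `h 0 ⊗ h 1 ⊗ ⋯ ⊗ h (n - 1)` of single-qubit operators. -/
def tensor {n : ℕ} (h : Fin n → Matrix (Fin 2) (Fin 2) ℂ) : Op n :=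
  Matrix.of fun x y => ∏ j, h j (x j) (y j)

/-- The `n`-qubit Pauli group: all `α h₁ ⊗ ⋯ ⊗ hₙ` with `α ∈ {±1, ±i}` and
`hⱼ ∈ {I, X, Y, Z}`. -/
def pauliGroup (n : ℕ) : Set (Op n) :=
  {g | ∃ α ∈ ({1, -1, Complex.I, -Complex.I} : Set ℂ),
    ∃ h : Fin n → Matrix (Fin 2) (Fin 2) ℂ,
      (∀ j, h j ∈ ({1, pauliX, pauliY, pauliZ} : Set (Matrix (Fin 2) (Fin 2) ℂ))) ∧
      g = α • tensor h}

/-- An `n`-qubit Clifford operator is a unitary `U` with `U 𝒢ₙ U† = 𝒢ₙ`, where `𝒢ₙ` is the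
Pauli group. -/
def IsClifford {n : ℕ} (U : Op n) : Prop :=
  U ∈ Matrix.unitaryGroup (Bits n) ℂ ∧ (fun g => U * g * Uᴴ) '' pauliGroup n = pauliGroup n

/-- The controlled-`Z` gate `diag (1, 1, 1, -1)`. -/
def cz : Op 2 := Matrix.diagonal fun x => if x 0 = 1 ∧ x 1 = 1 then -1 else 1

/-! ### Elementary steps -/

/-- The all-zero state `|0⟩^{⊗ m}`. -/
def zeroState (m : ℕ) : State m := Pi.single 0 1

/-- The operator `U` applied to the `k` qubits `q 0, …, q (k - 1)` (pairwise distinct) of an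
`m`-qubit register, and the identity to the other qubits. -/
def applyOp {k m : ℕ} (q : Fin k ↪ Fin m) (U : Op k) (ψ : State m) : State m :=
  fun x => ∑ y : Bits k, U (x ∘ q) y * ψ (Function.extend q y x)

/-- The unnormalized state of the other qubits after qubit `i` is measured in the computational
basis with outcome `b` and discarded; the other qubits keep their order. -/
def measured {m : ℕ} (i : Fin (m + 1)) (b : Fin 2) (ψ : State (m + 1)) : State m :=
  fun x => ψ (Fin.insertNth (α := fun _ => Fin 2) i b x)

/-- The squared Euclidean norm of a vector. -/
def normSq {m : ℕ} (ψ : State m) : ℝ := ∑ x, ‖ψ x‖ ^ 2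

/-! ### Adaptive algorithms -/

/-- `Algorithm n m`: adaptive quantum algorithms that act on `m` qubits and end with `n` qubits.
The steps are single-qubit Clifford operations, two-qubit Clifford operations, and measurements of
one qubit in the computational basis; a measured qubit is discarded, and everything that follows a
measurement may depend on its outcome. -/
inductive Algorithm (n : ℕ) : ℕ → Type
  /-- End; the `n` remaining qubits are the output. -/
  | output : Algorithm n n
  /-- Measure and discard qubit `i`, then continue with `next b`, where `b` is the outcome. -/
  | measure {m : ℕ} (i : Fin (m + 1)) (next : Fin 2 → Algorithm n m) : Algorithm n (m + 1)
  /-- Apply a single-qubit Clifford operator. -/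
  | clifford1 {m : ℕ} (q : Fin 1 ↪ Fin m) (U : Op 1) (hU : IsClifford U)
      (next : Algorithm n m) : Algorithm n m
  /-- Apply a two-qubit Clifford operator to an ordered pair of distinct qubits. -/
  | clifford2 {m : ℕ} (q : Fin 2 ↪ Fin m) (U : Op 2) (hU : IsClifford U)
      (next : Algorithm n m) : Algorithm n m

/-- The CZ-complexity of an algorithm: the maximum over the measurement outcomes of the number of
two-qubit Clifford operations. -/
def Algorithm.czComplexity {n : ℕ} : {m : ℕ} → Algorithm n m → ℕ
  | _, .output => 0
  | _, .measure _ next => max (next 0).czComplexity (next 1).czComplexity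
  | _, .clifford1 _ _ _ next => next.czComplexity
  | _, .clifford2 _ _ _ next => next.czComplexity + 1

/-- Every two-qubit Clifford operation that occurs in the algorithm is the CZ gate. -/
def Algorithm.OnlyCZ {n : ℕ} : {m : ℕ} → Algorithm n m → Prop
  | _, .output => True
  | _, .measure _ next => ∀ b, (next b).OnlyCZ
  | _, .clifford1 _ _ _ next => next.OnlyCZ
  | _, .clifford2 _ U _ next => U = cz ∧ next.OnlyCZ

open Classical in
/-- For an algorithm started on the vector `ψ`: the sum of the squared norms of the unnormalized
final vectors that satisfy `P`, over all measurement outcomes. If `ψ` is a unit vector and `P` is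
invariant under multiplication by scalars, this is the probability that the final state
satisfies `P` (Born rule). -/
def Algorithm.prob {n : ℕ} (P : State n → Prop) : {m : ℕ} → Algorithm n m → State m → ℝ
  | _, .output, ψ => if P ψ then normSq ψ else 0
  | _, .measure i next, ψ => ∑ b, (next b).prob P (measured i b ψ)
  | _, .clifford1 q U _ next, ψ => next.prob P (applyOp q U ψ)
  | _, .clifford2 q U _ next, ψ => next.prob P (applyOp q U ψ)

/-! ### Graph states -/

open Classical in
/-- The stabilizer generator `X_v ⊗ ⨂_{w ∈ N_G(v)} Z_w` of a graph state. -/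
def graphStabilizer {n : ℕ} (G : SimpleGraph (Fin n)) (v : Fin n) : Op n :=
  tensor fun w => if w = v then pauliX else if G.Adj v w then pauliZ else 1

/-- `ψ` lies in the line spanned by the graph state `|G⟩`, i.e. in the common fixed space of the
stabilizer generators. (The qubit `v` corresponds to the vertex `v`.) -/
def IsGraphState {n : ℕ} (G : SimpleGraph (Fin n)) (ψ : State n) : Prop :=
  ∀ v, graphStabilizer G v *ᵥ ψ = ψ

/-- The algorithm generates `|G⟩` from `|0⟩^{⊗ m}` with probability 1. -/
def Algorithm.Generates {n m : ℕ} (A : Algorithm n m) (G : SimpleGraph (Fin n)) : Prop :=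
  A.prob (IsGraphState G) (zeroState m) = 1

/-- The CZ-complexity of the graph state `|G⟩`: the minimum CZ-complexity of an algorithm that
generates `|G⟩` from `|0⟩^{⊗ (n + s)}` with probability 1 for some `s ≥ 0`. -/
def graphCZComplexity {n : ℕ} (G : SimpleGraph (Fin n)) : ℕ :=
  sInf {t | ∃ (s : ℕ) (A : Algorithm n (n + s)), A.Generates G ∧ A.czComplexity = t}

end

end QPrep

namespace QPrep

open scoped Matrix Kronecker

noncomputable section

/-! ### Phases and single-qubit Pauli matrices -/

/-- The phases of Pauli operators. -/
abbrev phases : Set ℂ := {1, -1, Complex.I, -Complex.I}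

/-- The single-qubit Pauli matrices, without phases. -/
abbrev paulis : Set (Matrix (Fin 2) (Fin 2) ℂ) := {1, pauliX, pauliY, pauliZ}

theorem mem_phases_iff {α : ℂ} : α ∈ phases ↔ α ^ 4 = 1 := by
  constructor
  · rintro (rfl | rfl | rfl | rfl)
    · norm_num
    · norm_num
    · exact Complex.I_pow_four
    · rw [neg_pow, Complex.I_pow_four]; norm_num
  · intro h
    have h1 : (α - 1) * ((α + 1) * ((α - Complex.I) * (α + Complex.I))) = 0 := by
      linear_combination h + (1 - α ^ 2) * Complex.I_sq
    rcases mul_eq_zero.1 h1 with h | h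
    · exact Or.inl (sub_eq_zero.1 h)
    rcases mul_eq_zero.1 h with h | h
    · exact Or.inr (Or.inl (eq_neg_of_add_eq_zero_left h))
    rcases mul_eq_zero.1 h with h | h
    · exact Or.inr (Or.inr (Or.inl (sub_eq_zero.1 h)))
    · exact Or.inr (Or.inr (Or.inr (eq_neg_of_add_eq_zero_left h)))

theorem one_mem_phases : (1 : ℂ) ∈ phases := Or.inl rfl

theorem neg_one_mem_phases : (-1 : ℂ) ∈ phases := Or.inr (Or.inl rfl)

theorem I_mem_phases : Complex.I ∈ phases := Or.inr (Or.inr (Or.inl rfl))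

theorem neg_I_mem_phases : -Complex.I ∈ phases := Or.inr (Or.inr (Or.inr rfl))

theorem mul_mem_phases {α β : ℂ} (hα : α ∈ phases) (hβ : β ∈ phases) : α * β ∈ phases := by
  rw [mem_phases_iff] at *
  rw [mul_pow, hα, hβ, one_mul]

theorem star_mem_phases {α : ℂ} (hα : α ∈ phases) : star α ∈ phases := by
  rw [mem_phases_iff] at *
  rw [← star_pow, hα, star_one]

theorem prod_mem_phases {ι : Type*} (s : Finset ι) {α : ι → ℂ} (h : ∀ i ∈ s, α i ∈ phases) :
    ∏ i ∈ s, α i ∈ phases := by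
  rw [mem_phases_iff, ← Finset.prod_pow]
  exact Finset.prod_eq_one fun i hi => mem_phases_iff.1 (h i hi)

theorem phases_ne_zero {α : ℂ} (hα : α ∈ phases) : α ≠ 0 := by
  rintro rfl
  rw [mem_phases_iff] at hα
  norm_num at hα

theorem star_mul_self_of_mem_phases {α : ℂ} (hα : α ∈ phases) : star α * α = 1 := by
  rcases hα with rfl | rfl | rfl | rfl <;> simp

theorem norm_of_mem_phases {α : ℂ} (hα : α ∈ phases) : ‖α‖ = 1 := by
  rcases hα with rfl | rfl | rfl | rfl <;> simp

theorem one_mem_paulis : (1 : Matrix (Fin 2) (Fin 2) ℂ) ∈ paulis := Or.inl rfl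

theorem pauliX_mem_paulis : pauliX ∈ paulis := Or.inr (Or.inl rfl)

theorem pauliY_mem_paulis : pauliY ∈ paulis := Or.inr (Or.inr (Or.inl rfl))

theorem pauliZ_mem_paulis : pauliZ ∈ paulis := Or.inr (Or.inr (Or.inr rfl))

theorem pauliX_mul_pauliX : pauliX * pauliX = 1 := by
  ext i j; fin_cases i <;> fin_cases j <;> simp [pauliX]

theorem pauliY_mul_pauliY : pauliY * pauliY = 1 := by
  ext i j; fin_cases i <;> fin_cases j <;> simp [pauliY]

theorem pauliZ_mul_pauliZ : pauliZ * pauliZ = 1 := by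
  ext i j; fin_cases i <;> fin_cases j <;> simp [pauliZ]

theorem pauliX_mul_pauliY : pauliX * pauliY = Complex.I • pauliZ := by
  ext i j; fin_cases i <;> fin_cases j <;> simp [pauliX, pauliY, pauliZ]

theorem pauliY_mul_pauliX : pauliY * pauliX = -Complex.I • pauliZ := by
  ext i j; fin_cases i <;> fin_cases j <;> simp [pauliX, pauliY, pauliZ]

theorem pauliY_mul_pauliZ : pauliY * pauliZ = Complex.I • pauliX := by
  ext i j; fin_cases i <;> fin_cases j <;> simp [pauliX, pauliY, pauliZ]

theorem pauliZ_mul_pauliY : pauliZ * pauliY = -Complex.I • pauliX := by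
  ext i j; fin_cases i <;> fin_cases j <;> simp [pauliX, pauliY, pauliZ]

theorem pauliZ_mul_pauliX : pauliZ * pauliX = Complex.I • pauliY := by
  ext i j; fin_cases i <;> fin_cases j <;> simp [pauliX, pauliY, pauliZ]

theorem pauliX_mul_pauliZ : pauliX * pauliZ = -Complex.I • pauliY := by
  ext i j; fin_cases i <;> fin_cases j <;> simp [pauliX, pauliY, pauliZ]

theorem paulis_mul {a b : Matrix (Fin 2) (Fin 2) ℂ} (ha : a ∈ paulis) (hb : b ∈ paulis) :
    ∃ γ ∈ phases, ∃ c ∈ paulis, a * b = γ • c := by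
  rcases ha with rfl | rfl | rfl | rfl
  · exact ⟨1, one_mem_phases, b, hb, by simp⟩
  · rcases hb with rfl | rfl | rfl | rfl
    · exact ⟨1, one_mem_phases, _, pauliX_mem_paulis, by simp⟩
    · exact ⟨1, one_mem_phases, _, one_mem_paulis, by simp [pauliX_mul_pauliX]⟩
    · exact ⟨_, I_mem_phases, _, pauliZ_mem_paulis, pauliX_mul_pauliY⟩
    · exact ⟨_, neg_I_mem_phases, _, pauliY_mem_paulis, pauliX_mul_pauliZ⟩
  · rcases hb with rfl | rfl | rfl | rfl
    · exact ⟨1, one_mem_phases, _, pauliY_mem_paulis, by simp⟩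
    · exact ⟨_, neg_I_mem_phases, _, pauliZ_mem_paulis, pauliY_mul_pauliX⟩
    · exact ⟨1, one_mem_phases, _, one_mem_paulis, by simp [pauliY_mul_pauliY]⟩
    · exact ⟨_, I_mem_phases, _, pauliX_mem_paulis, pauliY_mul_pauliZ⟩
  · rcases hb with rfl | rfl | rfl | rfl
    · exact ⟨1, one_mem_phases, _, pauliZ_mem_paulis, by simp⟩
    · exact ⟨_, I_mem_phases, _, pauliY_mem_paulis, pauliZ_mul_pauliX⟩
    · exact ⟨_, neg_I_mem_phases, _, pauliX_mem_paulis, pauliZ_mul_pauliY⟩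
    · exact ⟨1, one_mem_phases, _, one_mem_paulis, by simp [pauliZ_mul_pauliZ]⟩

theorem paulis_mul_self {a : Matrix (Fin 2) (Fin 2) ℂ} (ha : a ∈ paulis) : a * a = 1 := by
  rcases ha with rfl | rfl | rfl | rfl
  exacts [one_mul _, pauliX_mul_pauliX, pauliY_mul_pauliY, pauliZ_mul_pauliZ]

theorem paulis_conjTranspose {a : Matrix (Fin 2) (Fin 2) ℂ} (ha : a ∈ paulis) : aᴴ = a := by
  rcases ha with rfl | rfl | rfl | rfl
  · simp
  all_goals ext i j; fin_cases i <;> fin_cases j <;> simp [pauliX, pauliY, pauliZ]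

theorem paulis_ne_zero {a : Matrix (Fin 2) (Fin 2) ℂ} (ha : a ∈ paulis) : a ≠ 0 := by
  rintro rfl
  have := paulis_mul_self ha
  simp at this

/-- Distinct non-identity Pauli matrices anticommute. -/
theorem paulis_anticommute {a b : Matrix (Fin 2) (Fin 2) ℂ} (ha : a ∈ paulis) (hb : b ∈ paulis)
    (ha1 : a ≠ 1) (hb1 : b ≠ 1) (hab : a ≠ b) : a * b = -(b * a) := by
  rcases ha with rfl | rfl | rfl | rfl <;> rcases hb with rfl | rfl | rfl | rfl <;>
    first
    | exact absurd rfl ha1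
    | exact absurd rfl hb1
    | exact absurd rfl hab
    | simp [pauliX_mul_pauliY, pauliY_mul_pauliX, pauliY_mul_pauliZ, pauliZ_mul_pauliY,
        pauliZ_mul_pauliX, pauliX_mul_pauliZ]

theorem paulis_commute_or {a b : Matrix (Fin 2) (Fin 2) ℂ} (ha : a ∈ paulis) (hb : b ∈ paulis) :
    a * b = b * a ∨ a * b = -(b * a) := by
  by_cases ha1 : a = 1
  · left; simp [ha1]
  by_cases hb1 : b = 1
  · left; simp [hb1]
  by_cases hab : a = b
  · left; rw [hab]
  exact Or.inr (paulis_anticommute ha hb ha1 hb1 hab)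

theorem matrix_eq_zero_of_eq_neg {ι : Type*} {M : Matrix ι ι ℂ} (h : M = -M) : M = 0 :=
  Matrix.ext fun i j => self_eq_neg.1 (congrFun (congrFun h i) j)

/-! ### Tensor products -/

theorem tensor_mul {n : ℕ} (h k : Fin n → Matrix (Fin 2) (Fin 2) ℂ) :
    tensor h * tensor k = tensor fun j => h j * k j := by
  ext x y
  simp only [tensor, Matrix.mul_apply, Matrix.of_apply, ← Finset.prod_mul_distrib]
  exact (Fintype.prod_sum fun j z => h j (x j) z * k j z (y j)).symm

theorem tensor_one {n : ℕ} : tensor (fun _ : Fin n => 1) = 1 := by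
  ext x y
  simp only [tensor, Matrix.of_apply, Matrix.one_apply]
  by_cases h : x = y
  · simp [h]
  · obtain ⟨j, hj⟩ := Function.ne_iff.1 h
    rw [if_neg h]
    exact Finset.prod_eq_zero (Finset.mem_univ j) (if_neg hj)

theorem tensor_conjTranspose {n : ℕ} (h : Fin n → Matrix (Fin 2) (Fin 2) ℂ) :
    (tensor h)ᴴ = tensor fun j => (h j)ᴴ := by
  ext x y
  simp [tensor]

theorem tensor_smul {n : ℕ} (c : Fin n → ℂ) (h : Fin n → Matrix (Fin 2) (Fin 2) ℂ) :
    (tensor fun j => c j • h j) = (∏ j, c j) • tensor h := by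
  ext x y
  simp [tensor, Finset.prod_mul_distrib]

/-! ### The Pauli group -/

theorem smul_tensor_mem_pauliGroup {n : ℕ} {α : ℂ} (hα : α ∈ phases)
    {h : Fin n → Matrix (Fin 2) (Fin 2) ℂ} (hh : ∀ j, h j ∈ paulis) :
    α • tensor h ∈ pauliGroup n := ⟨α, hα, h, hh, rfl⟩

theorem tensor_mem_pauliGroup {n : ℕ} {h : Fin n → Matrix (Fin 2) (Fin 2) ℂ}
    (hh : ∀ j, h j ∈ paulis) : tensor h ∈ pauliGroup n :=
  ⟨1, one_mem_phases, h, hh, by simp⟩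

theorem one_mem_pauliGroup {n : ℕ} : (1 : Op n) ∈ pauliGroup n := by
  rw [← tensor_one]
  exact tensor_mem_pauliGroup fun _ => one_mem_paulis

theorem smul_mem_pauliGroup {n : ℕ} {α : ℂ} (hα : α ∈ phases) {g : Op n}
    (hg : g ∈ pauliGroup n) : α • g ∈ pauliGroup n := by
  obtain ⟨β, hβ, h, hh, rfl⟩ := hg
  rw [smul_smul]
  exact smul_tensor_mem_pauliGroup (mul_mem_phases hα hβ) hh

theorem mul_mem_pauliGroup {n : ℕ} {g k : Op n} (hg : g ∈ pauliGroup n) (hk : k ∈ pauliGroup n) :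
    g * k ∈ pauliGroup n := by
  obtain ⟨α, hα, h, hh, rfl⟩ := hg
  obtain ⟨β, hβ, l, hl, rfl⟩ := hk
  choose γ hγ c hc e using fun j => paulis_mul (hh j) (hl j)
  rw [Matrix.smul_mul, Matrix.mul_smul, tensor_mul]
  simp only [e]
  rw [tensor_smul]
  exact smul_mem_pauliGroup hα (smul_mem_pauliGroup hβ (smul_tensor_mem_pauliGroup
    (prod_mem_phases _ fun j _ => hγ j) hc))

theorem conjTranspose_mem_pauliGroup {n : ℕ} {g : Op n} (hg : g ∈ pauliGroup n) :
    gᴴ ∈ pauliGroup n := by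
  obtain ⟨α, hα, h, hh, rfl⟩ := hg
  rw [Matrix.conjTranspose_smul, tensor_conjTranspose]
  simp only [fun j => paulis_conjTranspose (hh j)]
  exact smul_tensor_mem_pauliGroup (star_mem_phases hα) hh

theorem conjTranspose_mul_self_of_mem_pauliGroup {n : ℕ} {g : Op n} (hg : g ∈ pauliGroup n) :
    gᴴ * g = 1 := by
  obtain ⟨α, hα, h, hh, rfl⟩ := hg
  rw [Matrix.conjTranspose_smul, tensor_conjTranspose, Matrix.smul_mul, Matrix.mul_smul, smul_smul,
    star_mul_self_of_mem_phases hα, one_smul, tensor_mul]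
  simp only [fun j => paulis_conjTranspose (hh j), fun j => paulis_mul_self (hh j), tensor_one]

theorem mem_unitaryGroup_of_mem_pauliGroup {n : ℕ} {g : Op n} (hg : g ∈ pauliGroup n) :
    g ∈ Matrix.unitaryGroup (Bits n) ℂ :=
  Matrix.mem_unitaryGroup_iff'.2 (conjTranspose_mul_self_of_mem_pauliGroup hg)

theorem pauliGroup_commute_or {n : ℕ} {g k : Op n} (hg : g ∈ pauliGroup n)
    (hk : k ∈ pauliGroup n) : g * k = k * g ∨ g * k = -(k * g) := by
  obtain ⟨α, hα, h, hh, rfl⟩ := hg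
  obtain ⟨β, hβ, l, hl, rfl⟩ := hk
  have key : ∀ j, ∃ ε : ℂ, (ε = 1 ∨ ε = -1) ∧ h j * l j = ε • (l j * h j) := fun j => by
    rcases paulis_commute_or (hh j) (hl j) with e | e
    · exact ⟨1, Or.inl rfl, by simp [e]⟩
    · exact ⟨-1, Or.inr rfl, by simp [e]⟩
  choose ε hε e using key
  have hprod : ∏ j, ε j = 1 ∨ ∏ j, ε j = -1 := by
    rw [← sq_eq_one_iff, ← Finset.prod_pow]
    exact Finset.prod_eq_one fun j _ => sq_eq_one_iff.2 (hε j)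
  have : (α • tensor h) * (β • tensor l) = (∏ j, ε j) • ((β • tensor l) * (α • tensor h)) := by
    simp only [Matrix.smul_mul, Matrix.mul_smul, tensor_mul, e, tensor_smul, smul_smul]
    congr 1
    ring
  rw [this]
  rcases hprod with e | e <;> simp [e]

theorem finite_pauliGroup (n : ℕ) : (pauliGroup n).Finite := by
  have h1 : (Set.univ.pi fun _ : Fin n => paulis).Finite :=
    Set.Finite.pi fun _ => Set.toFinite _
  have h2 : phases.Finite := Set.toFinite _
  refine ((h2.prod h1).image fun p => p.1 • tensor p.2).subset ?_
  rintro g ⟨α, hα, h, hh, rfl⟩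
  exact ⟨(α, h), ⟨hα, fun j _ => hh j⟩, rfl⟩

/-! ### Clifford operators -/

theorem isClifford_of_forall_mem {n : ℕ} {U : Op n} (hU : U ∈ Matrix.unitaryGroup (Bits n) ℂ)
    (h : ∀ g ∈ pauliGroup n, U * g * Uᴴ ∈ pauliGroup n) : IsClifford U := by
  refine ⟨hU, Set.eq_of_subset_of_ncard_le (Set.image_subset_iff.2 h) ?_ (finite_pauliGroup n)⟩
  rw [Set.ncard_image_of_injective]
  intro g k hgk
  have h1 : Uᴴ * U = 1 := Matrix.mem_unitaryGroup_iff'.1 hU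
  have : Uᴴ * (U * g * Uᴴ) * U = Uᴴ * (U * k * Uᴴ) * U := congrArg (fun M => Uᴴ * M * U) hgk
  simpa [Matrix.mul_assoc, h1, ← Matrix.mul_assoc Uᴴ U] using this

theorem IsClifford.conjTranspose_mul_self {n : ℕ} {U : Op n} (hU : IsClifford U) : Uᴴ * U = 1 :=
  Matrix.mem_unitaryGroup_iff'.1 hU.1

theorem IsClifford.mul_conjTranspose_self {n : ℕ} {U : Op n} (hU : IsClifford U) : U * Uᴴ = 1 :=
  Matrix.mem_unitaryGroup_iff.1 hU.1

theorem IsClifford.conj_mem {n : ℕ} {U g : Op n} (hU : IsClifford U) (hg : g ∈ pauliGroup n) :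
    U * g * Uᴴ ∈ pauliGroup n := hU.2 ▸ Set.mem_image_of_mem _ hg

theorem IsClifford.conj_mem' {n : ℕ} {U g : Op n} (hU : IsClifford U) (hg : g ∈ pauliGroup n) :
    Uᴴ * g * U ∈ pauliGroup n := by
  rw [← hU.2] at hg
  obtain ⟨k, hk, rfl⟩ := hg
  have h1 := hU.conjTranspose_mul_self
  simpa [Matrix.mul_assoc, h1, ← Matrix.mul_assoc Uᴴ U] using hk

theorem IsClifford.mul {n : ℕ} {U V : Op n} (hU : IsClifford U) (hV : IsClifford V) :
    IsClifford (U * V) := by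
  refine isClifford_of_forall_mem (mul_mem hU.1 hV.1) fun g hg => ?_
  simpa [Matrix.mul_assoc] using hU.conj_mem (hV.conj_mem hg)

/-! ### Operators on part of a register -/

/-- Splits the labels of a register into the labels of the qubits `q 0, …, q (k - 1)` and those of
the other qubits. -/
def bitsSplit {k m : ℕ} (q : Fin k ↪ Fin m) :
    Bits m ≃ Bits k × ({j // ¬ j ∈ Set.range q} → Fin 2) :=
  (Equiv.piEquivPiSubtypeProd (· ∈ Set.range q) fun _ => Fin 2).trans
    (((Equiv.ofInjective q q.injective).symm.arrowCongr (Equiv.refl _)).prodCongr (Equiv.refl _))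

theorem bitsSplit_fst {k m : ℕ} (q : Fin k ↪ Fin m) (x : Bits m) : (bitsSplit q x).1 = x ∘ q := by
  ext j
  simp [bitsSplit, Equiv.piEquivPiSubtypeProd]

theorem bitsSplit_snd {k m : ℕ} (q : Fin k ↪ Fin m) (x : Bits m) (j : {j // ¬ j ∈ Set.range q}) :
    (bitsSplit q x).2 j = x j := rfl

theorem bitsSplit_symm {k m : ℕ} (q : Fin k ↪ Fin m) (y : Bits k) (x : Bits m) :
    (bitsSplit q).symm (y, (bitsSplit q x).2) = Function.extend q y x := by
  rw [Equiv.symm_apply_eq]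
  refine Prod.ext ?_ ?_
  · rw [bitsSplit_fst]
    exact (Function.extend_comp q.injective y x).symm
  · funext j
    rw [bitsSplit_snd, bitsSplit_snd, Function.extend_apply' _ _ _ (by simpa using j.2)]

/-- The matrix of `applyOp q U`. -/
def opMat {k m : ℕ} (q : Fin k ↪ Fin m) (U : Op k) : Op m :=
  (U ⊗ₖ (1 : Matrix ({j // ¬ j ∈ Set.range q} → Fin 2) _ ℂ)).submatrix (bitsSplit q) (bitsSplit q)

theorem applyOp_eq_mulVec {k m : ℕ} (q : Fin k ↪ Fin m) (U : Op k) (ψ : State m) :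
    applyOp q U ψ = opMat q U *ᵥ ψ := by
  funext x
  rw [opMat, Matrix.submatrix_mulVec_equiv]
  simp only [applyOp, Function.comp_apply, Matrix.mulVec, dotProduct, Matrix.kroneckerMap_apply,
    Fintype.sum_prod_type, Matrix.one_apply, mul_ite, mul_one, mul_zero, ite_mul, zero_mul,
    Finset.sum_ite_eq, Finset.mem_univ, if_true, bitsSplit_symm, bitsSplit_fst]

theorem opMat_mul {k m : ℕ} (q : Fin k ↪ Fin m) (U V : Op k) :
    opMat q (U * V) = opMat q U * opMat q V := by
  rw [opMat, opMat, opMat, Matrix.submatrix_mul_equiv, ← Matrix.mul_kronecker_mul, one_mul]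

theorem opMat_conjTranspose {k m : ℕ} (q : Fin k ↪ Fin m) (U : Op k) :
    opMat q Uᴴ = (opMat q U)ᴴ := by
  rw [opMat, opMat, Matrix.conjTranspose_submatrix, Matrix.conjTranspose_kronecker,
    Matrix.conjTranspose_one]

theorem opMat_one {k m : ℕ} (q : Fin k ↪ Fin m) : opMat q 1 = 1 := by
  rw [opMat, Matrix.one_kronecker_one, Matrix.submatrix_one_equiv]

theorem opMat_mem_unitaryGroup {k m : ℕ} (q : Fin k ↪ Fin m) {U : Op k}
    (hU : U ∈ Matrix.unitaryGroup (Bits k) ℂ) : opMat q U ∈ Matrix.unitaryGroup (Bits m) ℂ := by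
  rw [Matrix.mem_unitaryGroup_iff', Matrix.star_eq_conjTranspose, ← opMat_conjTranspose,
    ← opMat_mul, ← Matrix.star_eq_conjTranspose, Matrix.mem_unitaryGroup_iff'.1 hU, opMat_one]

theorem applyOp_mul {k m : ℕ} (q : Fin k ↪ Fin m) (U V : Op k) (ψ : State m) :
    applyOp q (U * V) ψ = applyOp q U (applyOp q V ψ) := by
  rw [applyOp_eq_mulVec, applyOp_eq_mulVec, applyOp_eq_mulVec, opMat_mul, Matrix.mulVec_mulVec]

/-- The tensor product of the factors at the qubits other than `q 0, …, q (k - 1)`. -/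
def restTensor {k m : ℕ} (q : Fin k ↪ Fin m) (h : Fin m → Matrix (Fin 2) (Fin 2) ℂ) :
    Matrix ({j // ¬ j ∈ Set.range q} → Fin 2) ({j // ¬ j ∈ Set.range q} → Fin 2) ℂ :=
  Matrix.of fun x y => ∏ j : {j // ¬ j ∈ Set.range q}, h j (x j) (y j)

theorem restTensor_extend {k m : ℕ} (q : Fin k ↪ Fin m) (h : Fin k → Matrix (Fin 2) (Fin 2) ℂ)
    (l : Fin m → Matrix (Fin 2) (Fin 2) ℂ) :
    restTensor q (Function.extend q h l) = restTensor q l := by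
  ext x y
  simp only [restTensor, Matrix.of_apply]
  refine Finset.prod_congr rfl fun j _ => ?_
  rw [Function.extend_apply' _ _ _ (by simpa using j.2)]

theorem restTensor_one {k m : ℕ} (q : Fin k ↪ Fin m) : restTensor q (fun _ => 1) = 1 := by
  ext x y
  rw [restTensor, Matrix.of_apply, Matrix.one_apply]
  split_ifs with hxy
  · subst hxy
    exact Finset.prod_eq_one fun j _ => Matrix.one_apply_eq _
  · obtain ⟨j, hj⟩ := Function.ne_iff.1 hxy
    exact Finset.prod_eq_zero (Finset.mem_univ j) (Matrix.one_apply_ne hj)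

/-- A tensor product, split into the factors at the qubits `q 0, …, q (k - 1)` and the others. -/
theorem tensor_eq_submatrix {k m : ℕ} (q : Fin k ↪ Fin m) (h : Fin m → Matrix (Fin 2) (Fin 2) ℂ) :
    tensor h = (tensor (h ∘ q) ⊗ₖ restTensor q h).submatrix (bitsSplit q) (bitsSplit q) := by
  classical
  ext x y
  simp only [tensor, restTensor, Matrix.of_apply, Matrix.submatrix_apply,
    Matrix.kroneckerMap_apply, bitsSplit_fst, bitsSplit_snd, Function.comp_apply]
  rw [← Fintype.prod_subtype_mul_prod_subtype (· ∈ Set.range q)]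
  congr 1
  convert (Equiv.prod_comp (Equiv.ofInjective q q.injective)
    fun j => h j (x j) (y j)).symm using 1
  · exact Finset.prod_congr (Finset.ext fun _ => by simp) fun _ _ => rfl
  · rfl

theorem opMat_tensor {k m : ℕ} (q : Fin k ↪ Fin m) (h : Fin k → Matrix (Fin 2) (Fin 2) ℂ) :
    opMat q (tensor h) = tensor (Function.extend q h fun _ => 1) := by
  rw [tensor_eq_submatrix q, Function.extend_comp q.injective, opMat, restTensor_extend,
    restTensor_one]

theorem IsClifford.opMat {k m : ℕ} (q : Fin k ↪ Fin m) {U : Op k} (hU : IsClifford U) :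
    IsClifford (opMat q U) := by
  refine isClifford_of_forall_mem (opMat_mem_unitaryGroup q hU.1) ?_
  rintro _ ⟨α, hα, h, hh, rfl⟩
  rw [Matrix.mul_smul, Matrix.smul_mul]
  refine smul_mem_pauliGroup hα ?_
  obtain ⟨β, hβ, h', hh', e⟩ := hU.conj_mem (tensor_mem_pauliGroup fun j => hh (q j))
  have : QPrep.opMat q U * tensor h * (QPrep.opMat q U)ᴴ =
      β • tensor (Function.extend q h' h) := by
    rw [tensor_eq_submatrix q h, ← opMat_conjTranspose, QPrep.opMat, QPrep.opMat,
      Matrix.submatrix_mul_equiv, Matrix.submatrix_mul_equiv, ← Matrix.mul_kronecker_mul,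
      ← Matrix.mul_kronecker_mul, one_mul, mul_one, tensor_eq_submatrix q,
      Function.extend_comp q.injective, restTensor_extend]
    change ((U * tensor (fun j => h (q j)) * Uᴴ) ⊗ₖ _).submatrix _ _ = _
    rw [e, Matrix.smul_kronecker]
    rfl
  rw [this]
  refine smul_tensor_mem_pauliGroup hβ fun j => ?_
  by_cases hj : ∃ a, q a = j
  · obtain ⟨a, rfl⟩ := hj
    rw [q.injective.extend_apply]
    exact hh' a
  · rw [Function.extend_apply' _ _ _ hj]
    exact hh j

/-! ### Norms -/

theorem normSq_eq_dotProduct {m : ℕ} (ψ : State m) : (normSq ψ : ℂ) = star ψ ⬝ᵥ ψ := by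
  simp [normSq, dotProduct, Complex.conj_mul']

theorem normSq_mulVec {m : ℕ} {U : Op m} (hU : U ∈ Matrix.unitaryGroup (Bits m) ℂ) (ψ : State m) :
    normSq (U *ᵥ ψ) = normSq ψ := by
  apply Complex.ofReal_injective
  rw [normSq_eq_dotProduct, normSq_eq_dotProduct, Matrix.star_mulVec, ← Matrix.dotProduct_mulVec,
    Matrix.mulVec_mulVec, ← Matrix.star_eq_conjTranspose, Matrix.mem_unitaryGroup_iff'.1 hU,
    Matrix.one_mulVec]

theorem normSq_applyOp {k m : ℕ} (q : Fin k ↪ Fin m) {U : Op k}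
    (hU : U ∈ Matrix.unitaryGroup (Bits k) ℂ) (ψ : State m) :
    normSq (applyOp q U ψ) = normSq ψ := by
  rw [applyOp_eq_mulVec, normSq_mulVec (opMat_mem_unitaryGroup q hU)]

theorem normSq_smul {m : ℕ} (c : ℂ) (ψ : State m) : normSq (c • ψ) = ‖c‖ ^ 2 * normSq ψ := by
  simp [normSq, mul_pow, Finset.mul_sum]

theorem normSq_zero {m : ℕ} : normSq (0 : State m) = 0 := by simp [normSq]

theorem normSq_nonneg {m : ℕ} (ψ : State m) : 0 ≤ normSq ψ :=
  Finset.sum_nonneg fun _ _ => sq_nonneg _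

theorem normSq_eq_zero {m : ℕ} {ψ : State m} : normSq ψ = 0 ↔ ψ = 0 := by
  rw [normSq, Finset.sum_eq_zero_iff_of_nonneg fun _ _ => sq_nonneg _, funext_iff]
  simp

theorem normSq_zeroState (m : ℕ) : normSq (zeroState m) = 1 := by
  rw [normSq, Finset.sum_eq_single 0]
  · simp [zeroState]
  · intro x _ hx
    simp [zeroState, hx]
  · simp

theorem sum_normSq_measured {m : ℕ} (i : Fin (m + 1)) (ψ : State (m + 1)) :
    ∑ b, normSq (measured i b ψ) = normSq ψ := by
  rw [normSq, ← (Fin.insertNthEquiv (fun _ => Fin 2) i).sum_comp, Fintype.sum_prod_type]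
  rfl

theorem measured_smul {m : ℕ} (i : Fin (m + 1)) (b : Fin 2) (c : ℂ) (ψ : State (m + 1)) :
    measured i b (c • ψ) = c • measured i b ψ := rfl

theorem state_ext_measured {m : ℕ} (i : Fin (m + 1)) {ψ χ : State (m + 1)}
    (h : ∀ b, measured i b ψ = measured i b χ) : ψ = χ := by
  funext x
  have := congrFun (h (x i)) (i.removeNth x)
  simpa only [measured, Fin.insertNth_self_removeNth] using this

/-! ### Permutations of the qubits -/

/-- Permutes the qubits of a register. -/
def permState {m : ℕ} (σ : Equiv.Perm (Fin m)) (ψ : State m) : State m := fun x => ψ (x ∘ σ)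

theorem permState_permState {m : ℕ} (σ τ : Equiv.Perm (Fin m)) (ψ : State m) :
    permState σ (permState τ ψ) = permState (σ * τ) ψ := rfl

theorem permState_smul {m : ℕ} (σ : Equiv.Perm (Fin m)) (c : ℂ) (ψ : State m) :
    permState σ (c • ψ) = c • permState σ ψ := rfl

theorem normSq_permState {m : ℕ} (σ : Equiv.Perm (Fin m)) (ψ : State m) :
    normSq (permState σ ψ) = normSq ψ :=
  (σ.symm.arrowCongr (Equiv.refl (Fin 2))).sum_comp fun x => ‖ψ x‖ ^ 2

theorem permState_zeroState {m : ℕ} (σ : Equiv.Perm (Fin m)) :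
    permState σ (zeroState m) = zeroState m := by
  funext x
  have : x ∘ σ = 0 ↔ x = 0 := by
    constructor
    · intro h
      funext j
      simpa using congrFun h (σ.symm j)
    · rintro rfl; rfl
  simp only [permState, zeroState, Pi.single_apply, this]

theorem permState_applyOp {k m : ℕ} (σ : Equiv.Perm (Fin m)) (q : Fin k ↪ Fin m) (U : Op k)
    (ψ : State m) :
    permState σ (applyOp q U ψ) = applyOp (q.trans σ.toEmbedding) U (permState σ ψ) := by
  funext x
  refine Finset.sum_congr rfl fun y _ => ?_
  refine congrArg (fun z => U ((x ∘ σ) ∘ q) y * ψ z) ?_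
  funext j
  by_cases hj : ∃ a, q a = j
  · obtain ⟨a, rfl⟩ := hj
    rw [q.injective.extend_apply]
    exact ((q.trans σ.toEmbedding).injective.extend_apply y x a).symm
  · rw [Function.extend_apply' _ _ _ hj, Function.comp_apply, Function.comp_apply,
      Function.extend_apply' _ _ _ (by simpa using hj)]

theorem permState_mulVec_tensor {m : ℕ} (σ : Equiv.Perm (Fin m))
    (h : Fin m → Matrix (Fin 2) (Fin 2) ℂ) (ψ : State m) :
    permState σ (tensor h *ᵥ ψ) = tensor (h ∘ σ.symm) *ᵥ permState σ ψ := by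
  funext x
  rw [permState, Matrix.mulVec, dotProduct, Matrix.mulVec, dotProduct,
    ← (σ.symm.arrowCongr (Equiv.refl (Fin 2))).sum_comp]
  refine Finset.sum_congr rfl fun y _ => ?_
  have : (tensor h) (x ∘ σ) (y ∘ σ) = tensor (h ∘ σ.symm) x y := by
    simp only [tensor, Matrix.of_apply]
    refine Eq.trans ?_ (Equiv.prod_comp σ fun j => (h ∘ σ.symm) j (x j) (y j))
    simp
  exact congrArg (· * ψ (y ∘ σ)) this

theorem exists_permState_mulVec {m : ℕ} (σ : Equiv.Perm (Fin m)) {g : Op m}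
    (hg : g ∈ pauliGroup m) :
    ∃ k ∈ pauliGroup m, ∀ ψ, permState σ (g *ᵥ ψ) = k *ᵥ permState σ ψ := by
  obtain ⟨α, hα, h, hh, rfl⟩ := hg
  refine ⟨_, smul_tensor_mem_pauliGroup hα fun j => hh (σ.symm j), fun ψ => ?_⟩
  rw [Matrix.smul_mulVec, permState_smul, permState_mulVec_tensor, Matrix.smul_mulVec]
  rfl

/-- Every permutation of the qubits other than `i` extends to the whole register. -/
theorem exists_perm_measured {m : ℕ} (i : Fin (m + 1)) (σ : Equiv.Perm (Fin m)) :
    ∃ τ : Equiv.Perm (Fin (m + 1)), ∀ b ψ,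
      measured i b (permState τ ψ) = permState σ (measured i b ψ) := by
  refine ⟨(finSuccEquiv' i).trans ((Equiv.optionCongr σ).trans (finSuccEquiv' i).symm),
    fun b ψ => ?_⟩
  funext x
  refine congrArg ψ ?_
  funext j
  refine Fin.succAboveCases i ?_ (fun j => ?_) j
  · simp
  · simp

/-! ### Separating one qubit -/

/-- The tensor product of `a` at qubit `i` and `P` at the other qubits. -/
def insertOp {m : ℕ} (i : Fin (m + 1)) (a : Matrix (Fin 2) (Fin 2) ℂ) (P : Op m) : Op (m + 1) :=
  Matrix.of fun x y => a (x i) (y i) * P (fun j => x (i.succAbove j)) fun j => y (i.succAbove j)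

theorem sum_bits_succ {m : ℕ} {M : Type*} [AddCommMonoid M] (i : Fin (m + 1))
    (f : Bits (m + 1) → M) :
    ∑ x, f x = ∑ b, ∑ x, f (Fin.insertNth (α := fun _ => Fin 2) i b x) := by
  rw [← (Fin.insertNthEquiv (fun _ => Fin 2) i).sum_comp, Fintype.sum_prod_type]
  rfl

theorem measured_insertOp_mulVec {m : ℕ} (i : Fin (m + 1)) (a : Matrix (Fin 2) (Fin 2) ℂ)
    (P : Op m) (b : Fin 2) (ψ : State (m + 1)) :
    measured i b (insertOp i a P *ᵥ ψ) = ∑ c, a b c • (P *ᵥ measured i c ψ) := by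
  funext x
  rw [measured, Matrix.mulVec, dotProduct, sum_bits_succ i]
  simp [insertOp, Matrix.mulVec, dotProduct, measured, Finset.mul_sum, mul_assoc]

theorem insertOp_mul {m : ℕ} (i : Fin (m + 1)) (a b : Matrix (Fin 2) (Fin 2) ℂ) (P Q : Op m) :
    insertOp i a P * insertOp i b Q = insertOp i (a * b) (P * Q) := by
  ext x y
  rw [Matrix.mul_apply, sum_bits_succ i]
  simp only [insertOp, Matrix.of_apply, Fin.insertNth_apply_same, Fin.insertNth_apply_succAbove,
    Matrix.mul_apply, Finset.sum_mul_sum]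
  exact Finset.sum_congr rfl fun _ _ => Finset.sum_congr rfl fun _ _ => by ring

theorem insertOp_smul_left {m : ℕ} (i : Fin (m + 1)) (c : ℂ) (a : Matrix (Fin 2) (Fin 2) ℂ)
    (P : Op m) : insertOp i (c • a) P = c • insertOp i a P := by
  ext x y
  simp [insertOp, mul_assoc]

theorem insertOp_smul_right {m : ℕ} (i : Fin (m + 1)) (c : ℂ) (a : Matrix (Fin 2) (Fin 2) ℂ)
    (P : Op m) : insertOp i a (c • P) = c • insertOp i a P := by
  ext x y
  simp [insertOp, mul_left_comm]

theorem insertOp_neg_left {m : ℕ} (i : Fin (m + 1)) (a : Matrix (Fin 2) (Fin 2) ℂ)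
    (P : Op m) : insertOp i (-a) P = -insertOp i a P := by
  simpa using insertOp_smul_left i (-1) a P

theorem insertOp_neg_right {m : ℕ} (i : Fin (m + 1)) (a : Matrix (Fin 2) (Fin 2) ℂ)
    (P : Op m) : insertOp i a (-P) = -insertOp i a P := by
  simpa using insertOp_smul_right i (-1) a P

theorem insertOp_right_injective {m : ℕ} (i : Fin (m + 1)) {a : Matrix (Fin 2) (Fin 2) ℂ}
    (ha : a ≠ 0) : Function.Injective (insertOp i a : Op m → Op (m + 1)) := by
  intro P Q h
  obtain ⟨b, c, hbc⟩ : ∃ b c, a b c ≠ 0 := by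
    by_contra! h0
    exact ha (Matrix.ext h0)
  ext x y
  have := congrFun (congrFun h (Fin.insertNth (α := fun _ => Fin 2) i b x))
    (Fin.insertNth (α := fun _ => Fin 2) i c y)
  simpa [insertOp, hbc] using this

theorem tensor_eq_insertOp {m : ℕ} (i : Fin (m + 1)) (h : Fin (m + 1) → Matrix (Fin 2) (Fin 2) ℂ) :
    tensor h = insertOp i (h i) (tensor fun j => h (i.succAbove j)) := by
  ext x y
  simp [tensor, insertOp, Fin.prod_univ_succAbove _ i]

theorem exists_eq_insertOp {m : ℕ} (i : Fin (m + 1)) {g : Op (m + 1)} (hg : g ∈ pauliGroup (m + 1)) :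
    ∃ a ∈ paulis, ∃ P ∈ pauliGroup m, g = insertOp i a P := by
  obtain ⟨α, hα, h, hh, rfl⟩ := hg
  refine ⟨h i, hh i, _, smul_tensor_mem_pauliGroup hα fun j => hh (i.succAbove j), ?_⟩
  rw [insertOp_smul_right, tensor_eq_insertOp i]

theorem insertOp_mem_pauliGroup {m : ℕ} (i : Fin (m + 1)) {a : Matrix (Fin 2) (Fin 2) ℂ}
    (ha : a ∈ paulis) {P : Op m} (hP : P ∈ pauliGroup m) : insertOp i a P ∈ pauliGroup (m + 1) := by
  obtain ⟨α, hα, h, hh, rfl⟩ := hP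
  refine ⟨α, hα, Fin.insertNth (α := fun _ => Matrix (Fin 2) (Fin 2) ℂ) i a h, fun j => ?_, ?_⟩
  · refine Fin.succAboveCases i ?_ (fun j => ?_) j
    · simpa using ha
    · simpa using hh j
  · rw [insertOp_smul_right, tensor_eq_insertOp i]
    simp

/-! ### Stabilizer states -/

/-- `ψ` is a stabilizer vector: every Pauli operator either has `ψ` as an eigenvector or
anticommutes with a Pauli operator that fixes `ψ`. -/
def IsStabilizer {m : ℕ} (ψ : State m) : Prop :=
  ∀ g ∈ pauliGroup m, (∃ c : ℂ, g *ᵥ ψ = c • ψ) ∨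
    ∃ h ∈ pauliGroup m, h *ᵥ ψ = ψ ∧ g * h = -(h * g)

theorem IsStabilizer.mulVec {m : ℕ} {ψ : State m} (hψ : IsStabilizer ψ) {U : Op m}
    (hU : IsClifford U) : IsStabilizer (U *ᵥ ψ) := by
  intro g hg
  have h1 := hU.mul_conjTranspose_self
  have h2 := hU.conjTranspose_mul_self
  rcases hψ _ (hU.conj_mem' hg) with ⟨c, hc⟩ | ⟨h, hh, hfix, hanti⟩
  · refine Or.inl ⟨c, ?_⟩
    have := congrArg (fun χ => U *ᵥ χ) hc
    simpa [Matrix.mulVec_mulVec, ← Matrix.mul_assoc, h1, Matrix.mulVec_smul] using this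
  · refine Or.inr ⟨_, hU.conj_mem hh, ?_, ?_⟩
    · rw [Matrix.mulVec_mulVec, Matrix.mul_assoc, h2, mul_one, ← Matrix.mulVec_mulVec, hfix]
    · have := congrArg (fun M => U * M * Uᴴ) hanti
      have e1 : U * (Uᴴ * g * U * h) * Uᴴ = (U * Uᴴ) * (g * (U * h * Uᴴ)) := by
        simp only [Matrix.mul_assoc]
      have e2 : U * -(h * (Uᴴ * g * U)) * Uᴴ = -((U * h * Uᴴ) * g * (U * Uᴴ)) := by
        simp only [Matrix.mul_assoc, Matrix.mul_neg, Matrix.neg_mul]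
      simpa only [e1, e2, h1, one_mul, mul_one] using this

theorem IsStabilizer.applyOp {k m : ℕ} {ψ : State m} (hψ : IsStabilizer ψ) (q : Fin k ↪ Fin m)
    {U : Op k} (hU : IsClifford U) : IsStabilizer (applyOp q U ψ) := by
  rw [applyOp_eq_mulVec]
  exact hψ.mulVec (hU.opMat q)

theorem measured_mulVec_of_diagonal {m : ℕ} (i : Fin (m + 1)) {d : Matrix (Fin 2) (Fin 2) ℂ}
    (hd : d = 1 ∨ d = pauliZ) :
    ∀ b, ∃ ε : ℂ, (ε = 1 ∨ ε = -1) ∧ ∀ (P : Op m) (ψ : State (m + 1)),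
      measured i b (insertOp i d P *ᵥ ψ) = ε • (P *ᵥ measured i b ψ) := by
  intro b
  rcases hd with rfl | rfl
  · refine ⟨1, Or.inl rfl, fun P ψ => ?_⟩
    simp [measured_insertOp_mulVec, Matrix.one_apply]
  · fin_cases b
    · refine ⟨1, Or.inl rfl, fun P ψ => ?_⟩
      rw [measured_insertOp_mulVec]
      simp [pauliZ]
    · refine ⟨-1, Or.inr rfl, fun P ψ => ?_⟩
      rw [measured_insertOp_mulVec]
      simp [pauliZ]

theorem measured_mulVec_of_flip {m : ℕ} (i : Fin (m + 1)) {a : Matrix (Fin 2) (Fin 2) ℂ}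
    (ha : a = pauliX ∨ a = pauliY) {b c : Fin 2} (hbc : b ≠ c) :
    ∃ ε ∈ phases, ∀ (P : Op m) (ψ : State (m + 1)),
      measured i b (insertOp i a P *ᵥ ψ) = ε • (P *ᵥ measured i c ψ) := by
  have key : ∀ b c, b ≠ c → a b c ∈ phases ∧ a b b = 0 := by
    rcases ha with rfl | rfl <;> simp [Fin.forall_fin_two, pauliX, pauliY]
  obtain ⟨h1, h2⟩ := key b c hbc
  refine ⟨a b c, h1, fun P ψ => ?_⟩
  rw [measured_insertOp_mulVec, Fintype.sum_eq_single c]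
  intro d hd
  rw [show d = b by omega, h2, zero_smul]

theorem paulis_diagonal_or_flip {a : Matrix (Fin 2) (Fin 2) ℂ} (ha : a ∈ paulis) :
    (a = 1 ∨ a = pauliZ) ∨ (a = pauliX ∨ a = pauliY) := by
  rcases ha with h | h | h | h
  exacts [Or.inl (Or.inl h), Or.inr (Or.inl h), Or.inr (Or.inr h), Or.inl (Or.inr h)]

theorem flip_mul_flip {a b : Matrix (Fin 2) (Fin 2) ℂ} (ha : a = pauliX ∨ a = pauliY)
    (hb : b = pauliX ∨ b = pauliY) :
    ∃ γ ∈ phases, ∃ d, (d = 1 ∨ d = pauliZ) ∧ a * b = γ • d := by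
  rcases ha with rfl | rfl <;> rcases hb with rfl | rfl
  · exact ⟨1, one_mem_phases, 1, Or.inl rfl, by simp [pauliX_mul_pauliX]⟩
  · exact ⟨_, I_mem_phases, _, Or.inr rfl, pauliX_mul_pauliY⟩
  · exact ⟨_, neg_I_mem_phases, _, Or.inr rfl, pauliY_mul_pauliX⟩
  · exact ⟨1, one_mem_phases, 1, Or.inl rfl, by simp [pauliY_mul_pauliY]⟩

theorem diagonal_mem_paulis {d : Matrix (Fin 2) (Fin 2) ℂ} (hd : d = 1 ∨ d = pauliZ) :
    d ∈ paulis := by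
  rcases hd with rfl | rfl
  exacts [one_mem_paulis, pauliZ_mem_paulis]

theorem diagonal_commute {c d : Matrix (Fin 2) (Fin 2) ℂ} (hc : c = 1 ∨ c = pauliZ)
    (hd : d = 1 ∨ d = pauliZ) : c * d = d * c := by
  rcases hc with rfl | rfl <;> rcases hd with rfl | rfl <;> simp

theorem pauliZ_mul_flip {a : Matrix (Fin 2) (Fin 2) ℂ} (ha : a = pauliX ∨ a = pauliY) :
    pauliZ * a = -(a * pauliZ) := by
  rcases ha with rfl | rfl
  · simp [pauliZ_mul_pauliX, pauliX_mul_pauliZ]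
  · simp [pauliZ_mul_pauliY, pauliY_mul_pauliZ]

/-- If both outcomes of a measurement of a stabilizer vector are possible, some stabilizer flips the
measured qubit. -/
theorem IsStabilizer.exists_flip {m : ℕ} {i : Fin (m + 1)} {ψ : State (m + 1)} (hψ : IsStabilizer ψ)
    {b c : Fin 2} (hbc : b ≠ c) (hb : measured i b ψ ≠ 0) (hc : measured i c ψ ≠ 0) :
    ∃ a, (a = pauliX ∨ a = pauliY) ∧ ∃ P ∈ pauliGroup m, insertOp i a P *ᵥ ψ = ψ := by
  rcases hψ _ (insertOp_mem_pauliGroup i pauliZ_mem_paulis one_mem_pauliGroup) with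
    ⟨l, hl⟩ | ⟨h, hh, hfix, hanti⟩
  · exfalso
    have key : ∀ d, pauliZ d d • measured i d ψ = l • measured i d ψ := fun d => by
      rw [← measured_smul i d l, ← hl, measured_insertOp_mulVec]
      fin_cases d <;> simp [pauliZ]
    have h1 := smul_left_injective ℂ hb (key b)
    have h2 := smul_left_injective ℂ hc (key c)
    have hZ : ∀ b c : Fin 2, b ≠ c → pauliZ b b ≠ pauliZ c c := by
      intro b c
      fin_cases b <;> fin_cases c <;> norm_num [pauliZ]
    exact hZ b c hbc (h1.trans h2.symm)
  · obtain ⟨a, ha, P, hP, rfl⟩ := exists_eq_insertOp i hh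
    rcases paulis_diagonal_or_flip ha with h | h
    · exfalso
      rw [insertOp_mul, insertOp_mul, one_mul, mul_one, diagonal_commute (Or.inr rfl) h,
        ← insertOp_neg_right] at hanti
      have hne : a * pauliZ ≠ 0 := fun h0 => by
        have := congrArg (· * pauliZ) h0
        simp only [Matrix.mul_assoc, pauliZ_mul_pauliZ, mul_one, zero_mul] at this
        exact paulis_ne_zero ha this
      have hPP := insertOp_right_injective i hne hanti
      have hP0 : P = 0 := matrix_eq_zero_of_eq_neg hPP
      rw [hP0, show (0 : Op m) = (0 : ℂ) • 1 by simp, insertOp_smul_right, zero_smul,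
        Matrix.zero_mulVec] at hfix
      exact hb (by rw [← hfix]; rfl)
    · exact ⟨a, h, P, hP, hfix⟩

/-- The two vectors after the measurement of a qubit of a stabilizer vector differ by a Pauli
operator, unless one of them vanishes. -/
theorem IsStabilizer.exists_measured_eq {m : ℕ} {i : Fin (m + 1)} {ψ : State (m + 1)}
    (hψ : IsStabilizer ψ) {b c : Fin 2} (hbc : b ≠ c) (hb : measured i b ψ ≠ 0)
    (hc : measured i c ψ ≠ 0) :
    ∃ P ∈ pauliGroup m, measured i c ψ = P *ᵥ measured i b ψ := by
  obtain ⟨a, ha, P, hP, hfix⟩ := hψ.exists_flip hbc hb hc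
  obtain ⟨ε, hε, h⟩ := measured_mulVec_of_flip i ha hbc.symm
  refine ⟨ε • P, smul_mem_pauliGroup hε hP, ?_⟩
  rw [Matrix.smul_mulVec, ← h, hfix]

theorem IsStabilizer.measured {m : ℕ} {i : Fin (m + 1)} {ψ : State (m + 1)} (hψ : IsStabilizer ψ)
    {b : Fin 2} (hb : measured i b ψ ≠ 0) : IsStabilizer (measured i b ψ) := by
  obtain ⟨c, hbc⟩ : ∃ c, b ≠ c := ⟨b + 1, by fin_cases b <;> simp⟩
  -- a stabilizer that is diagonal at `i` restricts to the other qubits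
  have restrict : ∀ P Q : Op m, ∀ d e, (d = 1 ∨ d = pauliZ) → (e = 1 ∨ e = pauliZ) →
      Q ∈ pauliGroup m → insertOp i e Q *ᵥ ψ = ψ →
      insertOp i d P * insertOp i e Q = -(insertOp i e Q * insertOp i d P) →
      ∃ h ∈ pauliGroup m, h *ᵥ QPrep.measured i b ψ = QPrep.measured i b ψ ∧
        P * h = -(h * P) := by
    intro P Q d e hd he hQ hfix hanti
    obtain ⟨ε, hε, h⟩ := measured_mulVec_of_diagonal i he b
    refine ⟨ε • Q, smul_mem_pauliGroup ?_ hQ, ?_, ?_⟩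
    · rcases hε with rfl | rfl
      exacts [one_mem_phases, neg_one_mem_phases]
    · rw [Matrix.smul_mulVec, ← h, hfix]
    · rw [insertOp_mul, insertOp_mul, diagonal_commute hd he, ← insertOp_neg_right] at hanti
      have hne : e * d ≠ 0 := fun h0 => by
        have := congrArg (· * d) h0
        simp only [Matrix.mul_assoc, paulis_mul_self (diagonal_mem_paulis hd), mul_one,
          zero_mul] at this
        exact paulis_ne_zero (diagonal_mem_paulis he) this
      rw [Matrix.mul_smul, Matrix.smul_mul, insertOp_right_injective i hne hanti, smul_neg]
  have eigen : ∀ (P : Op m) d, (d = 1 ∨ d = pauliZ) → (∃ l : ℂ, insertOp i d P *ᵥ ψ = l • ψ) →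
      ∃ l : ℂ, P *ᵥ QPrep.measured i b ψ = l • QPrep.measured i b ψ := by
    rintro P d hd ⟨l, hl⟩
    obtain ⟨ε, hε, h⟩ := measured_mulVec_of_diagonal i hd b
    refine ⟨ε * l, ?_⟩
    rw [mul_smul, ← measured_smul, ← hl, h, smul_smul]
    rcases hε with rfl | rfl <;> simp
  intro P hP
  by_cases hc : QPrep.measured i c ψ = 0
  · rcases hψ _ (insertOp_mem_pauliGroup i one_mem_paulis hP) with hl | ⟨h, hh, hfix, hanti⟩
    · exact Or.inl (eigen P 1 (Or.inl rfl) hl)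
    · obtain ⟨a, ha, Q, hQ, rfl⟩ := exists_eq_insertOp i hh
      rcases paulis_diagonal_or_flip ha with h | h
      · exact Or.inr (restrict P Q 1 a (Or.inl rfl) h hQ hfix hanti)
      · obtain ⟨ε, -, h'⟩ := measured_mulVec_of_flip i h hbc
        refine absurd ?_ hb
        rw [← hfix, h', hc, Matrix.mulVec_zero, smul_zero]
  · obtain ⟨a₀, ha₀, P₀, hP₀, hfix₀⟩ := hψ.exists_flip hbc hb hc
    obtain ⟨d, hd, hcomm⟩ : ∃ d, (d = 1 ∨ d = pauliZ) ∧
        insertOp i d P * insertOp i a₀ P₀ = insertOp i a₀ P₀ * insertOp i d P := by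
      rcases pauliGroup_commute_or hP hP₀ with e | e
      · exact ⟨1, Or.inl rfl, by rw [insertOp_mul, insertOp_mul, e, one_mul, mul_one]⟩
      · refine ⟨pauliZ, Or.inr rfl, ?_⟩
        rw [insertOp_mul, insertOp_mul, e, pauliZ_mul_flip ha₀, insertOp_neg_left,
          insertOp_neg_right, neg_neg]
    rcases hψ _ (insertOp_mem_pauliGroup i (diagonal_mem_paulis hd) hP) with
      hl | ⟨h, hh, hfix, hanti⟩
    · exact Or.inl (eigen P d hd hl)
    · right
      obtain ⟨a, ha, Q, hQ, rfl⟩ := exists_eq_insertOp i hh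
      rcases paulis_diagonal_or_flip ha with h | h
      · exact restrict P Q d a hd h hQ hfix hanti
      · obtain ⟨γ, hγ, e, he, hmul⟩ := flip_mul_flip ha₀ h
        have hprod : insertOp i e (γ • (P₀ * Q)) = insertOp i a₀ P₀ * insertOp i a Q := by
          rw [insertOp_mul, hmul, insertOp_smul_left, insertOp_smul_right]
        refine restrict P (γ • (P₀ * Q)) d e hd he
          (smul_mem_pauliGroup hγ (mul_mem_pauliGroup hP₀ hQ)) ?_ ?_
        · rw [hprod, ← Matrix.mulVec_mulVec, hfix, hfix₀]
        · rw [hprod, ← Matrix.mul_assoc, hcomm, Matrix.mul_assoc, hanti, Matrix.mul_neg,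
            Matrix.mul_assoc]

theorem isStabilizer_zeroState (m : ℕ) : IsStabilizer (zeroState m) := by
  induction m with
  | zero =>
    intro g _
    refine Or.inl ⟨g 0 0, ?_⟩
    funext x
    rw [Subsingleton.elim x 0, Matrix.mulVec, dotProduct, Fintype.sum_subsingleton _ (0 : Bits 0)]
    rfl
  | succ m ih =>
    have h0 : measured 0 0 (zeroState (m + 1)) = zeroState m := by
      funext x
      simp only [measured, zeroState, Pi.single_apply]
      refine if_congr ?_ rfl rfl
      constructor
      · intro h
        funext j
        simpa using congrFun h j.succ
      · rintro rfl
        funext j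
        refine Fin.cases ?_ (fun j => ?_) j <;> simp
    have h1 : measured 0 1 (zeroState (m + 1)) = 0 := by
      funext x
      simp only [measured, zeroState, Pi.single_apply]
      refine if_neg fun h => ?_
      simpa using congrFun h 0
    have diag : ∀ (d : Matrix (Fin 2) (Fin 2) ℂ) (P : Op m) (l : ℂ), (d = 1 ∨ d = pauliZ) →
        P *ᵥ zeroState m = l • zeroState m →
        insertOp 0 d P *ᵥ zeroState (m + 1) = l • zeroState (m + 1) := by
      intro d P l hd hl
      refine state_ext_measured 0 fun b => ?_
      rw [measured_insertOp_mulVec, measured_smul]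
      rcases hd with rfl | rfl
      · fin_cases b <;> simp [h0, h1, hl, Matrix.one_apply]
      · fin_cases b <;> simp [h0, h1, hl, pauliZ]
    intro g hg
    obtain ⟨a, ha, P, hP, rfl⟩ := exists_eq_insertOp 0 hg
    rcases paulis_diagonal_or_flip ha with h | h
    · rcases ih P hP with ⟨l, hl⟩ | ⟨k, hk, hfix, hanti⟩
      · exact Or.inl ⟨l, diag a P l h hl⟩
      · refine Or.inr ⟨insertOp 0 1 k, insertOp_mem_pauliGroup 0 one_mem_paulis hk, ?_, ?_⟩
        · simpa using diag 1 k 1 (Or.inl rfl) (by simpa using hfix)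
        · rw [insertOp_mul, insertOp_mul, hanti, one_mul, mul_one, insertOp_neg_right]
    · refine Or.inr ⟨insertOp 0 pauliZ 1,
        insertOp_mem_pauliGroup 0 pauliZ_mem_paulis one_mem_pauliGroup, ?_, ?_⟩
      · simpa using diag pauliZ 1 1 (Or.inr rfl) (by simp)
      · rw [insertOp_mul, insertOp_mul, pauliZ_mul_flip h, insertOp_neg_left, neg_neg, one_mul,
          mul_one]

/-! ### Single-qubit Clifford matrices -/

/-- A single-qubit Clifford operator, as a `2 × 2` matrix. -/
structure IsLocalClifford (A : Matrix (Fin 2) (Fin 2) ℂ) : Prop where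
  mul_conjTranspose_self : A * Aᴴ = 1
  conj_mem : ∀ p ∈ paulis, ∃ α ∈ phases, ∃ r ∈ paulis, A * p * Aᴴ = α • r

theorem IsLocalClifford.conjTranspose_mul_self {A : Matrix (Fin 2) (Fin 2) ℂ}
    (hA : IsLocalClifford A) : Aᴴ * A = 1 :=
  mul_eq_one_comm.1 hA.mul_conjTranspose_self

theorem isClifford_tensor {n : ℕ} {h : Fin n → Matrix (Fin 2) (Fin 2) ℂ}
    (hh : ∀ j, IsLocalClifford (h j)) : IsClifford (tensor h) := by
  refine isClifford_of_forall_mem (Matrix.mem_unitaryGroup_iff.2 ?_) ?_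
  · rw [Matrix.star_eq_conjTranspose, tensor_conjTranspose, tensor_mul]
    simp only [fun j => (hh j).mul_conjTranspose_self, tensor_one]
  · rintro _ ⟨α, hα, k, hk, rfl⟩
    choose β hβ r hr e using fun j => (hh j).conj_mem (k j) (hk j)
    rw [Matrix.mul_smul, Matrix.smul_mul, tensor_conjTranspose, tensor_mul, tensor_mul]
    simp only [e, tensor_smul]
    exact smul_mem_pauliGroup hα
      (smul_tensor_mem_pauliGroup (prod_mem_phases _ fun j _ => hβ j) hr)

theorem isLocalClifford_of_mem_paulis {a : Matrix (Fin 2) (Fin 2) ℂ} (ha : a ∈ paulis) :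
    IsLocalClifford a := by
  refine ⟨by rw [paulis_conjTranspose ha, paulis_mul_self ha], fun p hp => ?_⟩
  rw [paulis_conjTranspose ha]
  rcases paulis_commute_or ha hp with e | e
  · exact ⟨1, one_mem_phases, p, hp, by rw [e, Matrix.mul_assoc, paulis_mul_self ha]; simp⟩
  · exact ⟨-1, neg_one_mem_phases, p, hp, by
      rw [e, Matrix.neg_mul, Matrix.mul_assoc, paulis_mul_self ha]; simp⟩

theorem isLocalClifford_one : IsLocalClifford 1 := isLocalClifford_of_mem_paulis one_mem_paulis

theorem IsLocalClifford.mul {A B : Matrix (Fin 2) (Fin 2) ℂ} (hA : IsLocalClifford A)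
    (hB : IsLocalClifford B) : IsLocalClifford (A * B) := by
  constructor
  · rw [Matrix.conjTranspose_mul, Matrix.mul_assoc, ← Matrix.mul_assoc B,
      hB.mul_conjTranspose_self, one_mul, hA.mul_conjTranspose_self]
  · intro p hp
    obtain ⟨α, hα, r, hr, e⟩ := hB.conj_mem p hp
    obtain ⟨β, hβ, s, hs, e'⟩ := hA.conj_mem r hr
    refine ⟨α * β, mul_mem_phases hα hβ, s, hs, ?_⟩
    rw [Matrix.conjTranspose_mul, show A * B * p * (Bᴴ * Aᴴ) = A * (B * p * Bᴴ) * Aᴴ by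
      simp only [Matrix.mul_assoc], e, Matrix.mul_smul, Matrix.smul_mul, e', smul_smul]

theorem semiconjBy_conjTranspose {ι : Type*} [Fintype ι] [DecidableEq ι] {U P Q : Matrix ι ι ℂ}
    (h : SemiconjBy U P Q) (h1 : Uᴴ * U = 1) : SemiconjBy Uᴴ Q P := by
  have h2 := mul_eq_one_comm.1 h1
  have : Uᴴ * (U * P) * Uᴴ = Uᴴ * (Q * U) * Uᴴ := congrArg (fun M => Uᴴ * M * Uᴴ) h
  rw [← Matrix.mul_assoc, h1, one_mul, Matrix.mul_assoc, Matrix.mul_assoc, h2, mul_one] at this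
  exact this.symm

theorem semiconjBy_smul {ι : Type*} [Fintype ι] [DecidableEq ι] {U P Q : Matrix ι ι ℂ} (c : ℂ)
    (h : SemiconjBy U P Q) : SemiconjBy U (c • P) (c • Q) := by
  rw [SemiconjBy, Matrix.mul_smul, Matrix.smul_mul, h.eq]

theorem IsLocalClifford.conjTranspose {A : Matrix (Fin 2) (Fin 2) ℂ} (hA : IsLocalClifford A) :
    IsLocalClifford Aᴴ := by
  refine ⟨by rw [Matrix.conjTranspose_conjTranspose, hA.conjTranspose_mul_self], fun p hp => ?_⟩
  have hT : IsClifford (tensor fun _ : Fin 1 => A) := isClifford_tensor fun _ => hA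
  obtain ⟨α, hα, k, hk, e⟩ := hT.conj_mem' (tensor_mem_pauliGroup (h := fun _ => p) fun _ => hp)
  rw [tensor_conjTranspose, tensor_mul, tensor_mul] at e
  refine ⟨α, hα, k 0, hk 0, ?_⟩
  rw [Matrix.conjTranspose_conjTranspose]
  ext s t
  simpa [tensor] using congrFun (congrFun e fun _ => s) fun _ => t

/-! ### Clifford operators that exchange two Pauli matrices -/

/-- The Clifford operator `(a + b) / √2`, which exchanges `a` and `b`. -/
def exchange (a b : Matrix (Fin 2) (Fin 2) ℂ) : Matrix (Fin 2) (Fin 2) ℂ :=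
  ((√2 : ℝ) : ℂ)⁻¹ • (a + b)

theorem inv_sqrt_two_mul_self : ((√2 : ℝ) : ℂ)⁻¹ * ((√2 : ℝ) : ℂ)⁻¹ = 2⁻¹ := by
  rw [← mul_inv, ← Complex.ofReal_mul, Real.mul_self_sqrt zero_le_two]
  simp

theorem exchange_conjTranspose {a b : Matrix (Fin 2) (Fin 2) ℂ} (ha : a ∈ paulis)
    (hb : b ∈ paulis) :
    (exchange a b)ᴴ = exchange a b := by
  rw [exchange, Matrix.conjTranspose_smul, Matrix.conjTranspose_add, paulis_conjTranspose ha,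
    paulis_conjTranspose hb]
  simp

theorem semiconjBy_exchange_left {a b : Matrix (Fin 2) (Fin 2) ℂ} (ha : a ∈ paulis)
    (hb : b ∈ paulis) :
    SemiconjBy (exchange a b) a b := by
  rw [exchange, SemiconjBy, Matrix.smul_mul, Matrix.mul_smul, add_mul, mul_add,
    paulis_mul_self ha, paulis_mul_self hb, add_comm]

theorem semiconjBy_exchange_right {a b : Matrix (Fin 2) (Fin 2) ℂ} (ha : a ∈ paulis)
    (hb : b ∈ paulis) :
    SemiconjBy (exchange a b) b a := by
  rw [exchange, SemiconjBy, Matrix.smul_mul, Matrix.mul_smul, add_mul, mul_add,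
    paulis_mul_self ha, paulis_mul_self hb, add_comm]

theorem exchange_mul_self {a b : Matrix (Fin 2) (Fin 2) ℂ} (ha : a ∈ paulis)
    (hb : b ∈ paulis) (hab : a * b = -(b * a)) :
    exchange a b * exchange a b = 1 := by
  rw [exchange, Matrix.smul_mul, Matrix.mul_smul, smul_smul, inv_sqrt_two_mul_self, mul_add,
    add_mul, add_mul, paulis_mul_self ha, paulis_mul_self hb, hab,
    show (1 : Matrix (Fin 2) (Fin 2) ℂ) + b * a + (-(b * a) + 1) = (2 : ℂ) • 1 by
      rw [two_smul]; abel, smul_smul]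
  simp

theorem semiconjBy_exchange_of_ne {a b c : Matrix (Fin 2) (Fin 2) ℂ} (hac : a * c = -(c * a))
    (hbc : b * c = -(c * b)) : SemiconjBy (exchange a b) c (-c) := by
  rw [exchange, SemiconjBy, Matrix.smul_mul, Matrix.mul_smul, add_mul, mul_add, hac, hbc,
    Matrix.neg_mul, Matrix.neg_mul]

theorem isLocalClifford_exchange {a b : Matrix (Fin 2) (Fin 2) ℂ} (ha : a ∈ paulis)
    (hb : b ∈ paulis) (ha1 : a ≠ 1) (hb1 : b ≠ 1) (hne : a ≠ b) :
    IsLocalClifford (exchange a b) := by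
  have hab := paulis_anticommute ha hb ha1 hb1 hne
  have hsq := exchange_mul_self ha hb hab
  refine ⟨by rw [exchange_conjTranspose ha hb, hsq], fun p hp => ?_⟩
  rw [exchange_conjTranspose ha hb]
  have key : ∀ q, SemiconjBy (exchange a b) p q → exchange a b * p * exchange a b = q :=
    fun q h => by rw [h.eq, Matrix.mul_assoc, hsq, mul_one]
  by_cases hp1 : p = 1
  · exact ⟨1, one_mem_phases, 1, one_mem_paulis, by rw [hp1, mul_one, hsq, one_smul]⟩
  by_cases hpa : p = a
  · exact ⟨1, one_mem_phases, b, hb, by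
      rw [key b (by rw [hpa]; exact semiconjBy_exchange_left ha hb), one_smul]⟩
  by_cases hpb : p = b
  · exact ⟨1, one_mem_phases, a, ha, by
      rw [key a (by rw [hpb]; exact semiconjBy_exchange_right ha hb), one_smul]⟩
  exact ⟨-1, neg_one_mem_phases, p, hp, by
    rw [key _ (semiconjBy_exchange_of_ne (paulis_anticommute ha hp ha1 hp1 (Ne.symm hpa))
      (paulis_anticommute hb hp hb1 hp1 (Ne.symm hpb))), neg_one_smul]⟩

theorem pauliX_ne_one : pauliX ≠ 1 := fun h => by simpa [pauliX] using congrFun (congrFun h 0) 0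

theorem pauliY_ne_one : pauliY ≠ 1 := fun h => by simpa [pauliY] using congrFun (congrFun h 0) 0

theorem pauliZ_ne_one : pauliZ ≠ 1 := fun h => by
  have := congrFun (congrFun h 1) 1
  norm_num [pauliZ] at this

theorem pauliX_ne_pauliZ : pauliX ≠ pauliZ := fun h => by
  simpa [pauliX, pauliZ] using congrFun (congrFun h 0) 0

theorem pauliY_ne_pauliZ : pauliY ≠ pauliZ := fun h => by
  simpa [pauliY, pauliZ] using congrFun (congrFun h 0) 0

theorem pauliX_ne_pauliY : pauliX ≠ pauliY := fun h => by
  have := congrArg Complex.re (congrFun (congrFun h 0) 1)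
  simp [pauliX, pauliY] at this

theorem isLocalClifford_exchangeXZ : IsLocalClifford (exchange pauliX pauliZ) :=
  isLocalClifford_exchange pauliX_mem_paulis pauliZ_mem_paulis pauliX_ne_one pauliZ_ne_one
    pauliX_ne_pauliZ

theorem isLocalClifford_exchangeXY : IsLocalClifford (exchange pauliX pauliY) :=
  isLocalClifford_exchange pauliX_mem_paulis pauliY_mem_paulis pauliX_ne_one pauliY_ne_one
    pauliX_ne_pauliY

theorem isLocalClifford_exchangeYZ : IsLocalClifford (exchange pauliY pauliZ) :=
  isLocalClifford_exchange pauliY_mem_paulis pauliZ_mem_paulis pauliY_ne_one pauliZ_ne_one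
    pauliY_ne_pauliZ

theorem exists_localClifford_up_to_sign {a b : Matrix (Fin 2) (Fin 2) ℂ} (ha : a ∈ paulis)
    (hb : b ∈ paulis) (ha1 : a ≠ 1) (hb1 : b ≠ 1) (hab : a ≠ b) :
    ∃ C, IsLocalClifford C ∧ (SemiconjBy C pauliX a ∨ SemiconjBy C pauliX (-a)) ∧
      (SemiconjBy C pauliZ b ∨ SemiconjBy C pauliZ (-b)) := by
  have antiXY := paulis_anticommute pauliX_mem_paulis pauliY_mem_paulis pauliX_ne_one
    pauliY_ne_one pauliX_ne_pauliY
  have antiXZ := paulis_anticommute pauliX_mem_paulis pauliZ_mem_paulis pauliX_ne_one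
    pauliZ_ne_one pauliX_ne_pauliZ
  have antiYZ := paulis_anticommute pauliY_mem_paulis pauliZ_mem_paulis pauliY_ne_one
    pauliZ_ne_one pauliY_ne_pauliZ
  have antiYX := neg_eq_iff_eq_neg.2 antiXY |>.symm
  have antiZX := neg_eq_iff_eq_neg.2 antiXZ |>.symm
  have XZ_X := semiconjBy_exchange_left pauliX_mem_paulis pauliZ_mem_paulis
  have XZ_Z := semiconjBy_exchange_right pauliX_mem_paulis pauliZ_mem_paulis
  have XY_X := semiconjBy_exchange_left pauliX_mem_paulis pauliY_mem_paulis
  have XY_Z := semiconjBy_exchange_of_ne antiXZ antiYZ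
  have YZ_Y := semiconjBy_exchange_left pauliY_mem_paulis pauliZ_mem_paulis
  have YZ_Z := semiconjBy_exchange_right pauliY_mem_paulis pauliZ_mem_paulis
  have YZ_X := semiconjBy_exchange_of_ne antiYX antiZX
  rcases ha with rfl | rfl | rfl | rfl <;> rcases hb with rfl | rfl | rfl | rfl
  case inl.inl | inl.inr.inl | inl.inr.inr.inl | inl.inr.inr.inr => exact absurd rfl ha1
  case inr.inl.inl | inr.inr.inl.inl | inr.inr.inr.inl => exact absurd rfl hb1
  case inr.inl.inr.inl | inr.inr.inl.inr.inr.inl | inr.inr.inr.inr.inr.inr => exact absurd rfl hab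
  case inr.inl.inr.inr.inl => exact ⟨_, isLocalClifford_exchangeYZ, Or.inr YZ_X, Or.inl YZ_Z⟩
  case inr.inl.inr.inr.inr =>
    exact ⟨1, isLocalClifford_one, Or.inl (SemiconjBy.one_left _), Or.inl (SemiconjBy.one_left _)⟩
  case inr.inr.inl.inr.inl =>
    exact ⟨_, isLocalClifford_exchangeYZ.mul isLocalClifford_exchangeXZ,
      Or.inl (YZ_Z.mul_left XZ_X), Or.inr (YZ_X.mul_left XZ_Z)⟩
  case inr.inr.inl.inr.inr.inr =>
    exact ⟨_, isLocalClifford_exchangeXY, Or.inl XY_X, Or.inr XY_Z⟩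
  case inr.inr.inr.inr.inl => exact ⟨_, isLocalClifford_exchangeXZ, Or.inl XZ_X, Or.inl XZ_Z⟩
  case inr.inr.inr.inr.inr.inl =>
    exact ⟨_, isLocalClifford_exchangeYZ.mul isLocalClifford_exchangeXY,
      Or.inl (YZ_Y.mul_left XY_X), Or.inr (YZ_Z.neg_right.mul_left XY_Z)⟩

/-- Single-qubit Clifford operators act transitively on the pairs of anticommuting signed Pauli
matrices. -/
theorem exists_localClifford {a b : Matrix (Fin 2) (Fin 2) ℂ} (ha : a ∈ paulis)
    (hb : b ∈ paulis) (ha1 : a ≠ 1) (hb1 : b ≠ 1) (hab : a ≠ b) {s t : ℂ} (hs : s = 1 ∨ s = -1)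
    (ht : t = 1 ∨ t = -1) :
    ∃ C, IsLocalClifford C ∧ SemiconjBy C pauliX (s • a) ∧ SemiconjBy C pauliZ (t • b) := by
  have h1 := paulis_anticommute ha hb ha1 hb1 hab
  have h2 := paulis_anticommute hb ha hb1 ha1 hab.symm
  have hbb : SemiconjBy b a (-a) := by rw [SemiconjBy, h2, Matrix.neg_mul]
  have haa : SemiconjBy a b (-b) := by rw [SemiconjBy, h1, Matrix.neg_mul]
  obtain ⟨C, hC, hX, hZ⟩ := exists_localClifford_up_to_sign ha hb ha1 hb1 hab
  obtain ⟨D, hD, hX, hZ⟩ : ∃ D, IsLocalClifford D ∧ SemiconjBy D pauliX (s • a) ∧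
      (SemiconjBy D pauliZ b ∨ SemiconjBy D pauliZ (-b)) := by
    have flip : IsLocalClifford (b * C) ∧
        (SemiconjBy (b * C) pauliZ b ∨ SemiconjBy (b * C) pauliZ (-b)) :=
      ⟨(isLocalClifford_of_mem_paulis hb).mul hC,
        hZ.imp (SemiconjBy.mul_left (Commute.refl b)) (SemiconjBy.mul_left (Commute.refl b).neg_right)⟩
    rcases hX with hX | hX <;> rcases hs with rfl | rfl
    · exact ⟨C, hC, by simpa using hX, hZ⟩
    · exact ⟨b * C, flip.1, by simpa using hbb.mul_left hX, flip.2⟩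
    · exact ⟨b * C, flip.1, by simpa using hbb.neg_right.mul_left hX, flip.2⟩
    · exact ⟨C, hC, by simpa using hX, hZ⟩
  have flip : IsLocalClifford (a * D) ∧ SemiconjBy (a * D) pauliX (s • a) :=
    ⟨(isLocalClifford_of_mem_paulis ha).mul hD,
      SemiconjBy.mul_left (semiconjBy_smul s (Commute.refl a)) hX⟩
  rcases hZ with hZ | hZ <;> rcases ht with rfl | rfl
  · exact ⟨D, hD, hX, by simpa using hZ⟩
  · exact ⟨a * D, flip.1, flip.2, by simpa using haa.mul_left hZ⟩
  · exact ⟨a * D, flip.1, flip.2, by simpa using haa.neg_right.mul_left hZ⟩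
  · exact ⟨D, hD, hX, by simpa using hZ⟩

/-! ### Two-qubit operators -/

/-- The tensor product of two single-qubit operators. -/
def pair (A B : Matrix (Fin 2) (Fin 2) ℂ) : Op 2 := tensor ![A, B]

theorem pair_apply (A B : Matrix (Fin 2) (Fin 2) ℂ) (x y : Bits 2) :
    pair A B x y = A (x 0) (y 0) * B (x 1) (y 1) := by
  simp [pair, tensor, Fin.prod_univ_two]

theorem pair_apply_vec (A B : Matrix (Fin 2) (Fin 2) ℂ) (a b c d : Fin 2) :
    pair A B ![a, b] ![c, d] = A a c * B b d := pair_apply A B _ _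

theorem tensor_eq_pair (h : Fin 2 → Matrix (Fin 2) (Fin 2) ℂ) : tensor h = pair (h 0) (h 1) := by
  ext x y
  simp [pair_apply, tensor, Fin.prod_univ_two]

theorem pair_mul (A B C D : Matrix (Fin 2) (Fin 2) ℂ) :
    pair A B * pair C D = pair (A * C) (B * D) := by
  rw [pair, pair, tensor_mul, tensor_eq_pair]
  rfl

theorem pair_one_one : pair 1 1 = 1 := by
  rw [← tensor_one, tensor_eq_pair]

theorem pair_conjTranspose (A B : Matrix (Fin 2) (Fin 2) ℂ) : (pair A B)ᴴ = pair Aᴴ Bᴴ := by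
  rw [pair, tensor_conjTranspose, tensor_eq_pair]
  rfl

theorem pair_smul_left (c : ℂ) (A B : Matrix (Fin 2) (Fin 2) ℂ) :
    pair (c • A) B = c • pair A B := by
  ext x y
  simp [pair_apply, mul_assoc]

theorem pair_smul_right (c : ℂ) (A B : Matrix (Fin 2) (Fin 2) ℂ) :
    pair A (c • B) = c • pair A B := by
  ext x y
  simp [pair_apply, mul_left_comm]

theorem pair_neg_left (A B : Matrix (Fin 2) (Fin 2) ℂ) : pair (-A) B = -pair A B := by
  simpa using pair_smul_left (-1) A B

theorem pair_neg_right (A B : Matrix (Fin 2) (Fin 2) ℂ) : pair A (-B) = -pair A B := by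
  simpa using pair_smul_right (-1) A B

theorem pair_mem_pauliGroup {a b : Matrix (Fin 2) (Fin 2) ℂ} (ha : a ∈ paulis) (hb : b ∈ paulis) :
    pair a b ∈ pauliGroup 2 :=
  tensor_mem_pauliGroup (by simpa [Fin.forall_fin_two] using ⟨ha, hb⟩)

theorem exists_eq_smul_pair {g : Op 2} (hg : g ∈ pauliGroup 2) :
    ∃ α ∈ phases, ∃ a ∈ paulis, ∃ b ∈ paulis, g = α • pair a b := by
  obtain ⟨α, hα, h, hh, rfl⟩ := hg
  exact ⟨α, hα, h 0, hh 0, h 1, hh 1, by rw [tensor_eq_pair]⟩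

theorem isClifford_pair {A B : Matrix (Fin 2) (Fin 2) ℂ} (hA : IsLocalClifford A)
    (hB : IsLocalClifford B) : IsClifford (pair A B) :=
  isClifford_tensor (by simpa [Fin.forall_fin_two] using ⟨hA, hB⟩)

theorem sum_bits_two {M : Type*} [AddCommMonoid M] (f : Bits 2 → M) :
    ∑ x, f x = f ![0, 0] + f ![0, 1] + (f ![1, 0] + f ![1, 1]) := by
  rw [← (finTwoArrowEquiv (Fin 2)).symm.sum_comp, Fintype.sum_prod_type]
  simp [Fin.sum_univ_two, finTwoArrowEquiv]

theorem op_two_ext {M N : Op 2} (h : ∀ a b c d, M ![a, b] ![c, d] = N ![a, b] ![c, d]) :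
    M = N := by
  ext x y
  have e : ∀ z : Bits 2, z = ![z 0, z 1] := fun z => by
    funext j; fin_cases j <;> rfl
  rw [e x, e y]
  exact h _ _ _ _

/-- An operator that commutes with all operators on the first qubit acts on the second qubit. -/
theorem exists_eq_pair_one {U : Op 2} (hX : SemiconjBy U (pair pauliX 1) (pair pauliX 1))
    (hZ : SemiconjBy U (pair pauliZ 1) (pair pauliZ 1)) : ∃ V, U = pair 1 V := by
  have eX : ∀ b d, U ![1, b] ![1, d] = U ![0, b] ![0, d] := by
    intro b d
    have := congrFun (congrFun hX.eq ![0, b]) ![1, d]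
    rw [Matrix.mul_apply, Matrix.mul_apply, sum_bits_two, sum_bits_two] at this
    simp only [pair_apply_vec, pauliX, Matrix.one_apply] at this
    revert this
    fin_cases b <;> fin_cases d <;> simp <;> exact Eq.symm
  have eZ : ∀ b d, U ![0, b] ![1, d] = 0 ∧ U ![1, b] ![0, d] = 0 := by
    intro b d
    have h1 := congrFun (congrFun hZ.eq ![0, b]) ![1, d]
    have h2 := congrFun (congrFun hZ.eq ![1, b]) ![0, d]
    rw [Matrix.mul_apply, Matrix.mul_apply, sum_bits_two, sum_bits_two] at h1 h2
    simp only [pair_apply_vec, pauliZ, Matrix.one_apply] at h1 h2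
    revert h1 h2
    fin_cases b <;> fin_cases d <;> simp [neg_eq_iff_add_eq_zero, eq_neg_iff_add_eq_zero] <;> tauto
  refine ⟨Matrix.of fun b d => U ![0, b] ![0, d], op_two_ext fun a b c d => ?_⟩
  rw [pair_apply_vec, Matrix.of_apply]
  match a, c with
  | 0, 0 => simp
  | 0, 1 => simpa using (eZ b d).1
  | 1, 0 => simpa using (eZ b d).2
  | 1, 1 => simpa using eX b d

theorem isLocalClifford_of_isClifford_pair_one {V : Matrix (Fin 2) (Fin 2) ℂ}
    (hV : IsClifford (pair 1 V)) : IsLocalClifford V := by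
  have h1 : V * Vᴴ = 1 := by
    have := hV.mul_conjTranspose_self
    rw [pair_conjTranspose, pair_mul, ← pair_one_one] at this
    ext s t
    simpa [pair_apply_vec] using congrFun (congrFun this ![0, s]) ![0, t]
  refine ⟨h1, fun p hp => ?_⟩
  obtain ⟨α, hα, a, ha, b, hb, e⟩ := exists_eq_smul_pair
    (hV.conj_mem (pair_mem_pauliGroup one_mem_paulis hp))
  rw [pair_conjTranspose, pair_mul, pair_mul] at e
  have e' : V * p * Vᴴ = (α * a 0 0) • b := by
    ext s t
    simpa [pair_apply_vec, mul_assoc] using congrFun (congrFun e ![0, s]) ![0, t]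
  have ha0 : a 0 0 = 0 ∨ a 0 0 = 1 := by
    rcases ha with rfl | rfl | rfl | rfl <;> simp [pauliX, pauliY, pauliZ]
  rcases ha0 with h | h
  · exfalso
    rw [h, mul_zero, zero_smul] at e'
    have h2 : Vᴴ * V = 1 := mul_eq_one_comm.1 h1
    have : Vᴴ * (V * p * Vᴴ) * V = 0 := by rw [e']; simp
    rw [Matrix.mul_assoc, Matrix.mul_assoc, h2, mul_one, ← Matrix.mul_assoc, h2, one_mul] at this
    exact paulis_ne_zero hp this
  · exact ⟨α, hα, b, hb, by rw [e', h, mul_one]⟩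

/-! ### The SWAP and CZ gates -/

/-- The SWAP gate. -/
def swapGate : Op 2 := Matrix.of fun x y => if y = x ∘ Equiv.swap 0 1 then 1 else 0

theorem swapGate_mul_apply (M : Op 2) (x y : Bits 2) :
    (swapGate * M) x y = M (x ∘ Equiv.swap 0 1) y := by
  simp [swapGate, Matrix.mul_apply]

theorem swapGate_mul_self : swapGate * swapGate = 1 := by
  ext x y
  rw [swapGate_mul_apply, swapGate, Matrix.of_apply, Matrix.one_apply]
  have : (x ∘ Equiv.swap 0 1) ∘ Equiv.swap 0 1 = x := by
    funext j; simp
  rw [this]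
  exact if_congr eq_comm rfl rfl

theorem swapGate_conjTranspose : swapGateᴴ = swapGate := by
  ext x y
  have : x = y ∘ Equiv.swap 0 1 ↔ y = x ∘ Equiv.swap 0 1 := by
    constructor <;> (rintro rfl; funext j; simp)
  simp only [Matrix.conjTranspose_apply, swapGate, Matrix.of_apply, this]
  split_ifs <;> simp

theorem semiconjBy_swapGate (A B : Matrix (Fin 2) (Fin 2) ℂ) :
    SemiconjBy swapGate (pair A B) (pair B A) := by
  have : swapGate * pair A B * swapGate = pair B A := by
    ext x y
    rw [Matrix.mul_assoc, swapGate_mul_apply, Matrix.mul_apply,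
      Finset.sum_eq_single (y ∘ Equiv.swap 0 1)]
    · simp [pair_apply, swapGate, mul_comm, funext_iff]
    · intro z _ hz
      have : ¬ y = z ∘ Equiv.swap 0 1 := by
        rintro rfl
        exact hz (by funext j; simp)
      simp [swapGate, this]
    · simp
  rw [SemiconjBy, ← this, Matrix.mul_assoc _ _ swapGate, swapGate_mul_self, mul_one]

theorem conj_mem_of_semiconjBy {n : ℕ} {U g k : Op n} (hU : U * Uᴴ = 1) (h : SemiconjBy U g k)
    (hk : k ∈ pauliGroup n) : U * g * Uᴴ ∈ pauliGroup n := by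
  rwa [h.eq, Matrix.mul_assoc, hU, mul_one]

theorem isClifford_swapGate : IsClifford swapGate := by
  have h1 : swapGate * swapGateᴴ = 1 := by rw [swapGate_conjTranspose, swapGate_mul_self]
  refine isClifford_of_forall_mem (Matrix.mem_unitaryGroup_iff.2 h1) fun g hg => ?_
  obtain ⟨α, hα, a, ha, b, hb, rfl⟩ := exists_eq_smul_pair hg
  exact conj_mem_of_semiconjBy h1 (semiconjBy_smul α (semiconjBy_swapGate a b))
    (smul_mem_pauliGroup hα (pair_mem_pauliGroup hb ha))

theorem applyOp_swapGate {m : ℕ} (q : Fin 2 ↪ Fin m) (ψ : State m) :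
    applyOp q swapGate ψ = permState (Equiv.swap (q 0) (q 1)) ψ := by
  funext x
  rw [applyOp, Finset.sum_eq_single ((x ∘ q) ∘ Equiv.swap 0 1)]
  · rw [swapGate, Matrix.of_apply, if_pos rfl, one_mul, permState]
    refine congrArg ψ ?_
    funext j
    by_cases hj : ∃ a, q a = j
    · obtain ⟨a, rfl⟩ := hj
      rw [q.injective.extend_apply, Function.comp_apply, Function.comp_apply, Function.comp_apply,
        q.injective.map_swap]
    · rw [Function.extend_apply' _ _ _ hj, Function.comp_apply, Equiv.swap_apply_of_ne_of_ne]
      · rintro rfl; exact hj ⟨0, rfl⟩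
      · rintro rfl; exact hj ⟨1, rfl⟩
  · intro y _ hy
    rw [swapGate, Matrix.of_apply, if_neg hy, zero_mul]
  · simp

theorem cz_mul_self : cz * cz = 1 := by
  rw [cz, Matrix.diagonal_mul_diagonal, ← Matrix.diagonal_one]
  congr 1
  funext x
  split_ifs <;> simp

theorem cz_conjTranspose : czᴴ = cz := by
  rw [cz, Matrix.diagonal_conjTranspose]
  congr 1
  funext x
  simp only [Pi.star_apply]
  split_ifs <;> simp

theorem semiconjBy_cz_pauliX_left : SemiconjBy cz (pair pauliX 1) (pair pauliX pauliZ) := by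
  refine op_two_ext fun a b c d => ?_
  rw [cz, Matrix.diagonal_mul, Matrix.mul_diagonal, pair_apply_vec, pair_apply_vec]
  fin_cases a <;> fin_cases b <;> fin_cases c <;> fin_cases d <;>
    simp [pauliX, pauliZ]

theorem semiconjBy_cz_pauliX_right : SemiconjBy cz (pair 1 pauliX) (pair pauliZ pauliX) := by
  refine op_two_ext fun a b c d => ?_
  rw [cz, Matrix.diagonal_mul, Matrix.mul_diagonal, pair_apply_vec, pair_apply_vec]
  fin_cases a <;> fin_cases b <;> fin_cases c <;> fin_cases d <;>
    simp [pauliX, pauliZ]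

theorem semiconjBy_cz_pauliZ_left : SemiconjBy cz (pair pauliZ 1) (pair pauliZ 1) := by
  refine op_two_ext fun a b c d => ?_
  rw [cz, Matrix.diagonal_mul, Matrix.mul_diagonal, pair_apply_vec]
  fin_cases a <;> fin_cases b <;> fin_cases c <;> fin_cases d <;>
    simp [pauliZ]

theorem semiconjBy_cz_pauliZ_right : SemiconjBy cz (pair 1 pauliZ) (pair 1 pauliZ) := by
  refine op_two_ext fun a b c d => ?_
  rw [cz, Matrix.diagonal_mul, Matrix.mul_diagonal, pair_apply_vec]
  fin_cases a <;> fin_cases b <;> fin_cases c <;> fin_cases d <;>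
    simp [pauliZ]

theorem pauliY_eq : pauliY = Complex.I • (pauliX * pauliZ) := by
  rw [pauliX_mul_pauliZ, smul_smul]
  simp

theorem isClifford_cz : IsClifford cz := by
  have h1 : cz * czᴴ = 1 := by rw [cz_conjTranspose, cz_mul_self]
  have hX := pauliX_mem_paulis
  have hZ := pauliZ_mem_paulis
  have left : ∀ a ∈ paulis, ∃ g ∈ pauliGroup 2, SemiconjBy cz (pair a 1) g := by
    rintro a (rfl | rfl | rfl | rfl)
    · exact ⟨1, one_mem_pauliGroup, by rw [pair_one_one]; exact SemiconjBy.one_right _⟩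
    · exact ⟨_, pair_mem_pauliGroup hX hZ, semiconjBy_cz_pauliX_left⟩
    · refine ⟨_, smul_mem_pauliGroup I_mem_phases (mul_mem_pauliGroup (pair_mem_pauliGroup hX hZ)
        (pair_mem_pauliGroup hZ one_mem_paulis)), ?_⟩
      rw [pauliY_eq, pair_smul_left, show pair (pauliX * pauliZ) 1 = pair pauliX 1 * pair pauliZ 1
        by rw [pair_mul, one_mul]]
      exact semiconjBy_smul _ (semiconjBy_cz_pauliX_left.mul_right semiconjBy_cz_pauliZ_left)
    · exact ⟨_, pair_mem_pauliGroup hZ one_mem_paulis, semiconjBy_cz_pauliZ_left⟩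
  have right : ∀ a ∈ paulis, ∃ g ∈ pauliGroup 2, SemiconjBy cz (pair 1 a) g := by
    rintro a (rfl | rfl | rfl | rfl)
    · exact ⟨1, one_mem_pauliGroup, by rw [pair_one_one]; exact SemiconjBy.one_right _⟩
    · exact ⟨_, pair_mem_pauliGroup hZ hX, semiconjBy_cz_pauliX_right⟩
    · refine ⟨_, smul_mem_pauliGroup I_mem_phases (mul_mem_pauliGroup (pair_mem_pauliGroup hZ hX)
        (pair_mem_pauliGroup one_mem_paulis hZ)), ?_⟩
      rw [pauliY_eq, pair_smul_right, show pair 1 (pauliX * pauliZ) = pair 1 pauliX * pair 1 pauliZ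
        by rw [pair_mul, one_mul]]
      exact semiconjBy_smul _ (semiconjBy_cz_pauliX_right.mul_right semiconjBy_cz_pauliZ_right)
    · exact ⟨_, pair_mem_pauliGroup one_mem_paulis hZ, semiconjBy_cz_pauliZ_right⟩
  refine isClifford_of_forall_mem (Matrix.mem_unitaryGroup_iff.2 h1) fun g hg => ?_
  obtain ⟨α, hα, a, ha, b, hb, rfl⟩ := exists_eq_smul_pair hg
  obtain ⟨k, hk, e⟩ := left a ha
  obtain ⟨l, hl, e'⟩ := right b hb
  have h := e.mul_right e'
  rw [pair_mul, one_mul, mul_one] at h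
  exact conj_mem_of_semiconjBy h1 (semiconjBy_smul α h)
    (smul_mem_pauliGroup hα (mul_mem_pauliGroup hk hl))

/-! ### Two-qubit Clifford operators in terms of CZ, SWAP and local operators -/

theorem exists_semiconjBy_pair {U : Op 2} (hU : IsClifford U) {p r : Matrix (Fin 2) (Fin 2) ℂ}
    (hp : p ∈ paulis) (hr : r ∈ paulis) :
    ∃ α ∈ phases, ∃ a ∈ paulis, ∃ b ∈ paulis, SemiconjBy U (pair p r) (α • pair a b) := by
  obtain ⟨α, hα, a, ha, b, hb, e⟩ := exists_eq_smul_pair (hU.conj_mem (pair_mem_pauliGroup hp hr))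
  refine ⟨α, hα, a, ha, b, hb, ?_⟩
  rw [SemiconjBy, ← e, Matrix.mul_assoc _ Uᴴ U, hU.conjTranspose_mul_self, mul_one]

theorem smul_right_cancel_of_isClifford {n : ℕ} {U : Op n} (hU : IsClifford U) {c d : ℂ}
    (h : c • U = d • U) : c = d := by
  have := congrArg (fun M => M * Uᴴ) h
  simp only [Matrix.smul_mul, hU.mul_conjTranspose_self] at this
  simpa using congrFun (congrFun this 0) 0

theorem sign_of_semiconjBy {n : ℕ} {U P Q : Op n} (hU : IsClifford U) {α : ℂ}
    (h : SemiconjBy U P (α • Q)) (hP : P * P = 1) (hQ : Q * Q = 1) : α = 1 ∨ α = -1 := by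
  have h2 := h.mul_right h
  rw [hP, Matrix.smul_mul, Matrix.mul_smul, hQ, smul_smul, SemiconjBy, mul_one, Matrix.smul_mul,
    one_mul] at h2
  have : α * α = 1 := (smul_right_cancel_of_isClifford hU (by rw [← h2, one_smul]))
  exact mul_self_eq_one_iff.1 this

theorem pair_mul_self {a b : Matrix (Fin 2) (Fin 2) ℂ} (ha : a ∈ paulis) (hb : b ∈ paulis) :
    pair a b * pair a b = 1 := by
  rw [pair_mul, paulis_mul_self ha, paulis_mul_self hb, pair_one_one]

theorem ne_of_anticommute {a b : Matrix (Fin 2) (Fin 2) ℂ} (ha : a ∈ paulis) (hb : b ∈ paulis)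
    (hab : a * b = -(b * a)) : a ≠ 1 ∧ b ≠ 1 ∧ a ≠ b := by
  refine ⟨?_, ?_, ?_⟩
  · rintro rfl
    exact paulis_ne_zero hb (matrix_eq_zero_of_eq_neg (by simpa using hab))
  · rintro rfl
    exact paulis_ne_zero ha (matrix_eq_zero_of_eq_neg (by simpa using hab))
  · rintro rfl
    rw [paulis_mul_self ha] at hab
    exact one_ne_zero (matrix_eq_zero_of_eq_neg hab)

theorem IsClifford.eq_pair_of_image_left {U : Op 2} (hU : IsClifford U)
    {x z : Matrix (Fin 2) (Fin 2) ℂ} {α β : ℂ} (hx : x ∈ paulis) (hz : z ∈ paulis)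
    (hxz : x * z = -(z * x)) (hX : SemiconjBy U (pair pauliX 1) (α • pair x 1))
    (hZ : SemiconjBy U (pair pauliZ 1) (β • pair z 1)) :
    ∃ A B, IsLocalClifford A ∧ IsLocalClifford B ∧ U = pair A B := by
  obtain ⟨hx1, hz1, hne⟩ := ne_of_anticommute hx hz hxz
  have hα := sign_of_semiconjBy hU hX (pair_mul_self pauliX_mem_paulis one_mem_paulis)
    (pair_mul_self hx one_mem_paulis)
  have hβ := sign_of_semiconjBy hU hZ (pair_mul_self pauliZ_mem_paulis one_mem_paulis)
    (pair_mul_self hz one_mem_paulis)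
  obtain ⟨A, hA, hAX, hAZ⟩ := exists_localClifford hx hz hx1 hz1 hne hα hβ
  have lift : ∀ {p r : Matrix (Fin 2) (Fin 2) ℂ} {c : ℂ}, SemiconjBy A p (c • r) →
      SemiconjBy (pair Aᴴ 1) (c • pair r 1) (pair p 1) := fun h => by
    rw [SemiconjBy, ← pair_smul_left, pair_mul, pair_mul,
      (semiconjBy_conjTranspose h hA.conjTranspose_mul_self).eq]
  obtain ⟨B, hB⟩ := exists_eq_pair_one ((lift hAX).mul_left hX) ((lift hAZ).mul_left hZ)
  refine ⟨A, B, hA, isLocalClifford_of_isClifford_pair_one (hB ▸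
    (isClifford_pair hA.conjTranspose isLocalClifford_one).mul hU), ?_⟩
  rw [← mul_one A, ← one_mul B, ← pair_mul A 1 1 B, ← hB, ← Matrix.mul_assoc, pair_mul,
    hA.mul_conjTranspose_self, one_mul, pair_one_one, one_mul]

theorem IsClifford.eq_pair_mul_cz {U : Op 2} (hU : IsClifford U)
    {x z p : Matrix (Fin 2) (Fin 2) ℂ} {α β : ℂ} (hx : x ∈ paulis) (hz : z ∈ paulis)
    (hp : p ∈ paulis) (hp1 : p ≠ 1)
    (hxz : x * z = -(z * x)) (hX : SemiconjBy U (pair pauliX 1) (α • pair x p))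
    (hZ : SemiconjBy U (pair pauliZ 1) (β • pair z 1)) :
    ∃ A B C, IsLocalClifford A ∧ IsLocalClifford B ∧ IsLocalClifford C ∧
      U = pair A B * (cz * pair 1 C) := by
  obtain ⟨hx1, hz1, hne⟩ := ne_of_anticommute hx hz hxz
  have hα := sign_of_semiconjBy hU hX (pair_mul_self pauliX_mem_paulis one_mem_paulis)
    (pair_mul_self hx hp)
  have hβ := sign_of_semiconjBy hU hZ (pair_mul_self pauliZ_mem_paulis one_mem_paulis)
    (pair_mul_self hz one_mem_paulis)
  obtain ⟨A, hA, hAX, hAZ⟩ := exists_localClifford hx hz hx1 hz1 hne hα hβ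
  obtain ⟨B, hB, hBZ⟩ : ∃ B, IsLocalClifford B ∧ SemiconjBy B pauliZ p := by
    obtain ⟨r, hr, hr1, hrp⟩ : ∃ r ∈ paulis, r ≠ 1 ∧ r ≠ p := by
      by_cases h : p = pauliX
      · exact ⟨pauliZ, pauliZ_mem_paulis, pauliZ_ne_one, h ▸ pauliX_ne_pauliZ.symm⟩
      · exact ⟨pauliX, pauliX_mem_paulis, pauliX_ne_one, Ne.symm h⟩
    obtain ⟨B, hB, -, hBZ⟩ := exists_localClifford hr hp hr1 hp1 hrp (Or.inl rfl) (Or.inl rfl)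
    exact ⟨B, hB, by simpa using hBZ⟩
  have hAX' : SemiconjBy (pair Aᴴ Bᴴ) (α • pair x p) (pair pauliX pauliZ) := by
    rw [SemiconjBy, ← pair_smul_left, pair_mul, pair_mul,
      (semiconjBy_conjTranspose hAX hA.conjTranspose_mul_self).eq,
      (semiconjBy_conjTranspose hBZ hB.conjTranspose_mul_self).eq]
  have hAZ' : SemiconjBy (pair Aᴴ Bᴴ) (β • pair z 1) (pair pauliZ 1) := by
    rw [SemiconjBy, ← pair_smul_left, pair_mul, pair_mul,
      (semiconjBy_conjTranspose hAZ hA.conjTranspose_mul_self).eq, one_mul, mul_one]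
  have hcz : SemiconjBy cz (pair pauliX pauliZ) (pair pauliX 1) := by
    have := semiconjBy_conjTranspose semiconjBy_cz_pauliX_left
      (by rw [cz_conjTranspose, cz_mul_self])
    rwa [cz_conjTranspose] at this
  obtain ⟨C, hC⟩ := exists_eq_pair_one ((hcz.mul_left hAX').mul_left hX)
    ((semiconjBy_cz_pauliZ_left.mul_left hAZ').mul_left hZ)
  refine ⟨A, B, C, hA, hB, isLocalClifford_of_isClifford_pair_one (hC ▸
    (isClifford_cz.mul (isClifford_pair hA.conjTranspose hB.conjTranspose)).mul hU), ?_⟩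
  rw [← hC, ← Matrix.mul_assoc, ← Matrix.mul_assoc, Matrix.mul_assoc _ cz, ← Matrix.mul_assoc cz cz,
    cz_mul_self, one_mul, ← pair_conjTranspose,
    (isClifford_pair hA hB).mul_conjTranspose_self, one_mul]

theorem IsClifford.eq_local_cz_local {U : Op 2} (hU : IsClifford U)
    {x z p r : Matrix (Fin 2) (Fin 2) ℂ} {α β : ℂ}
    (hx : x ∈ paulis) (hz : z ∈ paulis)
    (hp : p ∈ paulis) (hr : r ∈ paulis) (hpr : p * r = r * p)
    (hxz : x * z = -(z * x)) (hX : SemiconjBy U (pair pauliX 1) (α • pair x p))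
    (hZ : SemiconjBy U (pair pauliZ 1) (β • pair z r)) :
    ∃ A B C D, IsLocalClifford A ∧ IsLocalClifford B ∧ IsLocalClifford C ∧ IsLocalClifford D ∧
      (U = pair A B ∨ U = pair A B * (cz * pair C D)) := by
  obtain ⟨hx1, hz1, hne⟩ := ne_of_anticommute hx hz hxz
  have hzx : z * x = -(x * z) := by rw [hxz, neg_neg]
  -- a change of basis of the first qubit reduces to the preceding case
  have reduce : ∀ R x' z' (α' β' : ℂ), IsLocalClifford R → x' ∈ paulis → z' ∈ paulis →
      x' * z' = -(z' * x') → ∀ p', p' ∈ paulis → p' ≠ 1 →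
      SemiconjBy (U * pair R 1) (pair pauliX 1) (α' • pair x' p') →
      SemiconjBy (U * pair R 1) (pair pauliZ 1) (β' • pair z' 1) →
      ∃ A B C D, IsLocalClifford A ∧ IsLocalClifford B ∧ IsLocalClifford C ∧ IsLocalClifford D ∧
        (U = pair A B ∨ U = pair A B * (cz * pair C D)) := by
    intro R x' z' α' β' hR hx' hz' hxz' p' hp' hp1' hX' hZ'
    obtain ⟨A, B, C, hA, hB, hC, e⟩ := (hU.mul (isClifford_pair hR isLocalClifford_one)).eq_pair_mul_cz
      hx' hz' hp' hp1' hxz' hX' hZ'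
    refine ⟨A, B, Rᴴ, C, hA, hB, hR.conjTranspose, hC, Or.inr ?_⟩
    have := congrArg (fun M => M * pair Rᴴ 1) e
    simpa only [Matrix.mul_assoc, pair_mul, hR.mul_conjTranspose_self, one_mul, mul_one,
      pair_one_one] using this
  by_cases hr1 : r = 1
  · subst hr1
    by_cases hp1 : p = 1
    · subst hp1
      obtain ⟨A, B, hA, hB, e⟩ := hU.eq_pair_of_image_left hx hz hxz hX hZ
      exact ⟨A, B, 1, 1, hA, hB, isLocalClifford_one, isLocalClifford_one, Or.inl e⟩
    · exact reduce 1 x z α β isLocalClifford_one hx hz hxz p hp hp1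
        (by rwa [pair_one_one, mul_one]) (by rwa [pair_one_one, mul_one])
  have lift : ∀ {R s t : Matrix (Fin 2) (Fin 2) ℂ}, SemiconjBy R s t →
      SemiconjBy (pair R 1) (pair s 1) (pair t 1) := fun h => by
    rw [SemiconjBy, pair_mul, pair_mul, h.eq]
  by_cases hp1 : p = 1
  · subst hp1
    exact reduce _ z x β α isLocalClifford_exchangeXZ hz hx hzx r hr hr1
      (hZ.mul_left (lift (semiconjBy_exchange_left pauliX_mem_paulis pauliZ_mem_paulis)))
      (hX.mul_left (lift (semiconjBy_exchange_right pauliX_mem_paulis pauliZ_mem_paulis)))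
  have hpr' : p = r := by
    by_contra h
    have h1 := paulis_anticommute hp hr hp1 hr1 h
    rw [hpr] at h1
    have h2 : r * p = 0 := matrix_eq_zero_of_eq_neg h1
    refine paulis_ne_zero hp ?_
    rw [← one_mul p, ← paulis_mul_self hr, Matrix.mul_assoc, h2, Matrix.mul_zero]
  subst hpr'
  obtain ⟨γ, hγ, c, hc, e⟩ := paulis_mul hx hz
  obtain ⟨R, hR, hRX, hRZ⟩ := exists_localClifford pauliX_mem_paulis pauliY_mem_paulis
    pauliX_ne_one pauliY_ne_one pauliX_ne_pauliY (s := 1) (t := 1) (Or.inl rfl) (Or.inl rfl)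
  rw [one_smul] at hRX hRZ
  have hxc : x * c = -(c * x) := by
    have h1 : γ • (x * c) = γ • (-(c * x)) := by
      rw [← Matrix.mul_smul, ← e, ← Matrix.mul_assoc, smul_neg, ← Matrix.smul_mul, ← e,
        Matrix.mul_assoc, Matrix.mul_assoc x z x, hzx, Matrix.mul_neg, neg_neg]
    exact smul_right_injective _ (phases_ne_zero hγ) h1
  refine reduce R x c α (Complex.I * (α * β * γ)) hR hx hc hxc p hp hp1
    (hX.mul_left (lift hRX)) ?_
  have hY : SemiconjBy U (pair pauliY 1) ((Complex.I * (α * β * γ)) • pair c 1) := by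
    have h1 := semiconjBy_smul Complex.I (hX.mul_right hZ)
    rw [pair_mul, one_mul, ← pair_smul_left, ← pauliY_eq, Matrix.smul_mul, Matrix.mul_smul, pair_mul,
      e, paulis_mul_self hp, pair_smul_left, smul_smul, smul_smul, smul_smul] at h1
    simpa only [mul_assoc] using h1
  exact hY.mul_left (lift hRZ)

/-- Up to single-qubit Clifford operators, and to a SWAP gate at the end, every two-qubit Clifford
operator is the identity or CZ. -/
theorem IsClifford.exists_decomposition {U : Op 2} (hU : IsClifford U) :
    ∃ S W A B C D, (S = 1 ∨ S = swapGate) ∧ (W = 1 ∨ W = cz) ∧ IsLocalClifford A ∧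
      IsLocalClifford B ∧ IsLocalClifford C ∧ IsLocalClifford D ∧
      U = S * (pair A B * (W * pair C D)) := by
  have finish : ∀ S V : Op 2, (S = 1 ∨ S = swapGate) → U = S * V →
      (∃ A B C D, IsLocalClifford A ∧ IsLocalClifford B ∧ IsLocalClifford C ∧ IsLocalClifford D ∧
        (V = pair A B ∨ V = pair A B * (cz * pair C D))) →
      ∃ S W A B C D, (S = 1 ∨ S = swapGate) ∧ (W = 1 ∨ W = cz) ∧ IsLocalClifford A ∧
        IsLocalClifford B ∧ IsLocalClifford C ∧ IsLocalClifford D ∧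
        U = S * (pair A B * (W * pair C D)) := by
    rintro S V hS e ⟨A, B, C, D, hA, hB, hC, hD, h | h⟩
    · exact ⟨S, 1, A, B, 1, 1, hS, Or.inl rfl, hA, hB, isLocalClifford_one, isLocalClifford_one,
        by rw [e, h, pair_one_one, mul_one, mul_one]⟩
    · exact ⟨S, cz, A, B, C, D, hS, Or.inr rfl, hA, hB, hC, hD, by rw [e, h]⟩
  obtain ⟨α, hα, x, hx, p, hp, hX⟩ := exists_semiconjBy_pair hU pauliX_mem_paulis one_mem_paulis
  obtain ⟨β, hβ, z, hz, r, hr, hZ⟩ := exists_semiconjBy_pair hU pauliZ_mem_paulis one_mem_paulis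
  have anti : pair (x * z) (p * r) = -pair (z * x) (r * p) := by
    have hXZ : pair pauliX 1 * pair pauliZ 1 = -(pair pauliZ 1 * pair pauliX 1) := by
      rw [pair_mul, pair_mul, paulis_anticommute pauliX_mem_paulis pauliZ_mem_paulis pauliX_ne_one
        pauliZ_ne_one pauliX_ne_pauliZ, pair_neg_left]
    have h1 := hX.mul_right hZ
    have h2 := (hZ.mul_right hX).neg_right
    rw [← hXZ, Matrix.smul_mul, Matrix.mul_smul, pair_mul, smul_smul] at h2
    rw [Matrix.smul_mul, Matrix.mul_smul, pair_mul, smul_smul] at h1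
    have h3 := congrArg (fun M => M * Uᴴ) (h1.eq.symm.trans h2.eq)
    simp only [Matrix.mul_assoc, hU.mul_conjTranspose_self, mul_one] at h3
    rw [mul_comm β α, ← smul_neg] at h3
    rw [← pair_mul, ← pair_mul]
    exact smul_right_injective _ (phases_ne_zero (mul_mem_phases hα hβ)) h3
  have not_self_neg : ∀ {a b : Matrix (Fin 2) (Fin 2) ℂ}, a = z * x → b = r * p →
      pair a b ≠ -pair a b := by
    rintro _ _ rfl rfl h
    have h0 : pair z r * pair x p = 0 := by
      rw [pair_mul]
      exact matrix_eq_zero_of_eq_neg h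
    have h1 : (1 : Op 2) = 0 := by
      rw [← pair_mul_self hz hr, ← mul_one (pair z r * pair z r), ← pair_mul_self hx hp,
        Matrix.mul_assoc, ← Matrix.mul_assoc (pair z r) (pair x p), h0, Matrix.zero_mul,
        Matrix.mul_zero]
    exact one_ne_zero h1
  rcases paulis_commute_or hx hz with h1 | h1 <;> rcases paulis_commute_or hp hr with h2 | h2
  · rw [h1, h2] at anti
    exact absurd anti (not_self_neg rfl rfl)
  · refine finish swapGate (swapGate * U) (Or.inr rfl) ?_ ?_
    · rw [← Matrix.mul_assoc, swapGate_mul_self, one_mul]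
    · exact (isClifford_swapGate.mul hU).eq_local_cz_local hp hr hx hz h1 h2
        ((semiconjBy_smul α (semiconjBy_swapGate x p)).mul_left hX)
        ((semiconjBy_smul β (semiconjBy_swapGate z r)).mul_left hZ)
  · exact finish 1 U (Or.inl rfl) (by rw [one_mul])
      (hU.eq_local_cz_local hx hz hp hr h2 h1 hX hZ)
  · rw [h1, h2, pair_neg_left, pair_neg_right, neg_neg] at anti
    exact absurd anti (not_self_neg rfl rfl)

/-! ### Probabilities -/

theorem Algorithm.prob_nonneg {n m : ℕ} (P : State n → Prop) (A : Algorithm n m) (ψ : State m) :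
    0 ≤ A.prob P ψ := by
  induction A with
  | output =>
    rw [Algorithm.prob]
    split_ifs
    exacts [normSq_nonneg ψ, le_rfl]
  | measure i next ih => exact Finset.sum_nonneg fun b _ => ih b _
  | clifford1 q U hU next ih => exact ih _
  | clifford2 q U hU next ih => exact ih _

theorem Algorithm.prob_le_normSq {n m : ℕ} (P : State n → Prop) (A : Algorithm n m) (ψ : State m) :
    A.prob P ψ ≤ normSq ψ := by
  induction A with
  | output =>
    rw [Algorithm.prob]
    split_ifs
    exacts [le_rfl, normSq_nonneg ψ]
  | measure i next ih =>
    rw [← sum_normSq_measured i]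
    exact Finset.sum_le_sum fun b _ => ih b _
  | clifford1 q U hU next ih => exact (ih _).trans_eq (normSq_applyOp q hU.1 ψ)
  | clifford2 q U hU next ih => exact (ih _).trans_eq (normSq_applyOp q hU.1 ψ)

theorem Algorithm.prob_zero {n m : ℕ} (P : State n → Prop) (A : Algorithm n m) :
    A.prob P 0 = 0 :=
  le_antisymm ((A.prob_le_normSq P 0).trans_eq normSq_zero) (A.prob_nonneg P 0)

theorem Algorithm.prob_smul {n m : ℕ} {P : State n → Prop}
    (hP : ∀ c : ℂ, c ≠ 0 → ∀ ψ, P (c • ψ) ↔ P ψ) {c : ℂ} (hc : c ≠ 0) (A : Algorithm n m)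
    (ψ : State m) : A.prob P (c • ψ) = ‖c‖ ^ 2 * A.prob P ψ := by
  induction A with
  | output =>
    rw [Algorithm.prob, Algorithm.prob, normSq_smul]
    by_cases h : P ψ
    · rw [if_pos h, if_pos ((hP c hc ψ).2 h)]
    · rw [if_neg h, if_neg (mt (hP c hc ψ).1 h), mul_zero]
  | measure i next ih =>
    simp only [Algorithm.prob, measured_smul, ih, Finset.mul_sum]
  | clifford1 q U hU next ih =>
    rw [Algorithm.prob, Algorithm.prob, applyOp_eq_mulVec, Matrix.mulVec_smul, ih,
      applyOp_eq_mulVec]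
  | clifford2 q U hU next ih =>
    rw [Algorithm.prob, Algorithm.prob, applyOp_eq_mulVec, Matrix.mulVec_smul, ih,
      applyOp_eq_mulVec]

/-! ### Local operations -/

/-- The embedding of a single qubit into a register. -/
def qubit {m : ℕ} (a : Fin m) : Fin 1 ↪ Fin m := ⟨fun _ => a, Function.injective_of_subsingleton _⟩

/-- An algorithm can be preceded by single-qubit Clifford operators on all qubits. -/
theorem Algorithm.exists_local {n m : ℕ} (B : Algorithm n m)
    {h : Fin m → Matrix (Fin 2) (Fin 2) ℂ} (hh : ∀ j, IsLocalClifford (h j)) :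
    ∃ B' : Algorithm n m, (B.OnlyCZ → B'.OnlyCZ) ∧ B'.czComplexity = B.czComplexity ∧
      ∀ P ψ, B'.prob P ψ = B.prob P (tensor h *ᵥ ψ) := by
  suffices H : ∀ s : Finset (Fin m), ∃ B' : Algorithm n m, (B.OnlyCZ → B'.OnlyCZ) ∧
      B'.czComplexity = B.czComplexity ∧
      ∀ P ψ, B'.prob P ψ = B.prob P ((tensor fun j => if j ∈ s then h j else 1) *ᵥ ψ) by
    simpa using H Finset.univ
  intro s
  induction s using Finset.induction_on with
  | empty => exact ⟨B, id, rfl, fun P ψ => by simp [tensor_one]⟩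
  | insert a s ha ih =>
    obtain ⟨B', h1, h2, h3⟩ := ih
    refine ⟨.clifford1 (qubit a) (tensor fun _ => h a) (isClifford_tensor fun _ => hh a) B', h1, h2,
      fun P ψ => ?_⟩
    rw [Algorithm.prob, h3, applyOp_eq_mulVec, opMat_tensor, Matrix.mulVec_mulVec, tensor_mul]
    congr 3
    funext j
    by_cases hj : j = a
    · subst hj
      have := (qubit j).injective.extend_apply (fun _ => h j) (fun _ => 1) 0
      rw [show qubit j 0 = j from rfl] at this
      simp [ha, this]
    · rw [Function.extend_apply' _ _ _ fun ⟨b, hb⟩ => hj (hb.symm.trans rfl)]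
      simp [hj]

/-- An algorithm can be preceded by a Pauli operator. -/
theorem Algorithm.exists_pauli {n m : ℕ} {P : State n → Prop}
    (hP : ∀ c : ℂ, c ≠ 0 → ∀ ψ, P (c • ψ) ↔ P ψ) (B : Algorithm n m) {g : Op m}
    (hg : g ∈ pauliGroup m) :
    ∃ B' : Algorithm n m, (B.OnlyCZ → B'.OnlyCZ) ∧ B'.czComplexity = B.czComplexity ∧
      ∀ ψ, B'.prob P ψ = B.prob P (g *ᵥ ψ) := by
  obtain ⟨α, hα, h, hh, rfl⟩ := hg
  obtain ⟨B', h1, h2, h3⟩ := B.exists_local fun j => isLocalClifford_of_mem_paulis (hh j)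
  refine ⟨B', h1, h2, fun ψ => ?_⟩
  rw [h3, Matrix.smul_mulVec, B.prob_smul hP (phases_ne_zero hα), norm_of_mem_phases hα]
  simp

/-! ### Simulation with CZ gates -/

/-- Up to a permutation of the qubits, an algorithm with at most `t` two-qubit operations, all of
them CZ, takes `ψ` to a vector that satisfies `P` with certainty. -/
def CZReaches {n m : ℕ} (P : State n → Prop) (ψ : State m) (t : ℕ) : Prop :=
  ∃ (σ : Equiv.Perm (Fin m)) (B : Algorithm n m), B.OnlyCZ ∧ B.czComplexity ≤ t ∧
    B.prob P (permState σ ψ) = normSq ψ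

variable {n m : ℕ} {P : State n → Prop}

theorem CZReaches.mono {ψ : State m} {s t : ℕ} (h : CZReaches P ψ s) (hst : s ≤ t) :
    CZReaches P ψ t := by
  obtain ⟨σ, B, h1, h2, h3⟩ := h
  exact ⟨σ, B, h1, h2.trans hst, h3⟩

theorem CZReaches.of_clifford1 {ψ : State m} {t : ℕ} {q : Fin 1 ↪ Fin m} {U : Op 1}
    (hU : IsClifford U) (h : CZReaches P (applyOp q U ψ) t) : CZReaches P ψ t := by
  obtain ⟨σ, B, h1, h2, h3⟩ := h
  refine ⟨σ, .clifford1 (q.trans σ.toEmbedding) U hU B, h1, h2, ?_⟩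
  rw [Algorithm.prob, ← permState_applyOp, h3, normSq_applyOp q hU.1]

theorem CZReaches.of_cz {ψ : State m} {t : ℕ} {q : Fin 2 ↪ Fin m}
    (h : CZReaches P (applyOp q cz ψ) t) : CZReaches P ψ (t + 1) := by
  obtain ⟨σ, B, h1, h2, h3⟩ := h
  refine ⟨σ, .clifford2 (q.trans σ.toEmbedding) cz isClifford_cz B, ⟨rfl, h1⟩,
    Nat.succ_le_succ h2, ?_⟩
  rw [Algorithm.prob, ← permState_applyOp, h3, normSq_applyOp q isClifford_cz.1]

theorem CZReaches.of_permState {ψ : State m} {t : ℕ} {τ : Equiv.Perm (Fin m)}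
    (h : CZReaches P (permState τ ψ) t) : CZReaches P ψ t := by
  obtain ⟨σ, B, h1, h2, h3⟩ := h
  exact ⟨σ * τ, B, h1, h2, by rw [← permState_permState, h3, normSq_permState]⟩

theorem CZReaches.of_pair {ψ : State m} {t : ℕ} {q : Fin 2 ↪ Fin m}
    {A B : Matrix (Fin 2) (Fin 2) ℂ} (hA : IsLocalClifford A) (hB : IsLocalClifford B)
    (h : CZReaches P (applyOp q (pair A B) ψ) t) : CZReaches P ψ t := by
  obtain ⟨σ, C, h1, h2, h3⟩ := h
  have hloc : ∀ j, IsLocalClifford (Function.extend q ![A, B] (fun _ => 1) j) := fun j => by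
    by_cases hj : ∃ a, q a = j
    · obtain ⟨a, rfl⟩ := hj
      rw [q.injective.extend_apply]
      fin_cases a
      exacts [hA, hB]
    · rw [Function.extend_apply' _ _ _ hj]
      exact isLocalClifford_one
  obtain ⟨C', h1', h2', h3'⟩ := C.exists_local fun j => hloc (σ.symm j)
  refine ⟨σ, C', h1' h1, h2'.trans_le h2, ?_⟩
  have h4 : normSq (applyOp q (pair A B) ψ) = normSq ψ :=
    normSq_applyOp q (isClifford_pair hA hB).1 ψ
  rw [h3', ← h4, ← h3, applyOp_eq_mulVec, pair, opMat_tensor, permState_mulVec_tensor]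
  rfl

theorem CZReaches.of_clifford2 {ψ : State m} {t : ℕ} {q : Fin 2 ↪ Fin m} {U : Op 2}
    (hU : IsClifford U) (h : CZReaches P (applyOp q U ψ) t) : CZReaches P ψ (t + 1) := by
  obtain ⟨S, W, A, B, C, D, hS, hW, hA, hB, hC, hD, rfl⟩ := hU.exists_decomposition
  rw [applyOp_mul, applyOp_mul, applyOp_mul] at h
  refine CZReaches.of_pair (q := q) hC hD ?_
  have h1 : CZReaches P (applyOp q W (applyOp q (pair C D) ψ)) t := by
    refine CZReaches.of_pair (q := q) hA hB ?_
    rcases hS with rfl | rfl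
    · rwa [applyOp_eq_mulVec q 1, opMat_one, Matrix.one_mulVec] at h
    · rw [applyOp_swapGate] at h
      exact h.of_permState
  rcases hW with rfl | rfl
  · rw [applyOp_eq_mulVec q 1, opMat_one, Matrix.one_mulVec] at h1
    exact h1.mono t.le_succ
  · exact h1.of_cz

theorem CZReaches.of_measured (hP : ∀ c : ℂ, c ≠ 0 → ∀ ψ, P (c • ψ) ↔ P ψ) {ψ : State (m + 1)}
    (hψ : IsStabilizer ψ) {i : Fin (m + 1)} {b : Fin 2} (hb : measured i b ψ ≠ 0) {t : ℕ}
    (h : CZReaches P (measured i b ψ) t) : CZReaches P ψ t := by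
  obtain ⟨σ, B, h1, h2, h3⟩ := h
  have branch : ∀ d, ∃ B' : Algorithm n m, B'.OnlyCZ ∧ B'.czComplexity ≤ t ∧
      B'.prob P (permState σ (measured i d ψ)) = normSq (measured i d ψ) := by
    intro d
    by_cases hbd : b = d
    · exact hbd ▸ ⟨B, h1, h2, h3⟩
    by_cases hd : measured i d ψ = 0
    · refine ⟨B, h1, h2, ?_⟩
      rw [hd, normSq_zero]
      exact B.prob_zero P
    · obtain ⟨g, hg, e⟩ := hψ.exists_measured_eq hbd hb hd
      obtain ⟨k, hk, e'⟩ := exists_permState_mulVec σ hg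
      obtain ⟨B', h1', h2', h3'⟩ := B.exists_pauli hP (conjTranspose_mem_pauliGroup hk)
      refine ⟨B', h1' h1, h2'.trans_le h2, ?_⟩
      rw [e, normSq_mulVec (mem_unitaryGroup_of_mem_pauliGroup hg), e', h3', Matrix.mulVec_mulVec,
        conjTranspose_mul_self_of_mem_pauliGroup hk, Matrix.one_mulVec, h3]
  choose next hn1 hn2 hn3 using branch
  obtain ⟨τ, hτ⟩ := exists_perm_measured i σ
  refine ⟨τ, .measure i next, hn1, max_le (hn2 0) (hn2 1), ?_⟩
  rw [Algorithm.prob, ← sum_normSq_measured i]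
  exact Finset.sum_congr rfl fun d _ => by rw [hτ, hn3]

/-- Two-qubit Clifford operations can be replaced by CZ gates, up to a permutation of the qubits at
the beginning. -/
theorem Algorithm.czReaches (hP : ∀ c : ℂ, c ≠ 0 → ∀ ψ, P (c • ψ) ↔ P ψ) (A : Algorithm n m)
    {ψ : State m} (hψ : IsStabilizer ψ) (h0 : ψ ≠ 0) (hA : A.prob P ψ = normSq ψ) :
    CZReaches P ψ A.czComplexity := by
  induction A with
  | output => exact ⟨1, .output, trivial, le_rfl, hA⟩
  | measure i next ih =>
    obtain ⟨b, hb⟩ : ∃ b, measured i b ψ ≠ 0 := by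
      by_contra! h
      exact h0 (state_ext_measured i h)
    rw [← sum_normSq_measured i] at hA
    have hA' := (Finset.sum_eq_sum_iff_of_le fun b _ =>
      (next b).prob_le_normSq P (measured i b ψ)).1 hA b (Finset.mem_univ b)
    refine CZReaches.of_measured hP hψ hb ((ih b (hψ.measured hb) hb hA').mono ?_)
    match b with
    | 0 => exact le_max_left _ _
    | 1 => exact le_max_right _ _
  | clifford1 q U hU next ih =>
    have h1 : normSq (applyOp q U ψ) = normSq ψ := normSq_applyOp q hU.1 ψ
    refine CZReaches.of_clifford1 (q := q) hU (ih (hψ.applyOp q hU) ?_ (hA.trans h1.symm))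
    rwa [Ne, ← normSq_eq_zero, h1, normSq_eq_zero]
  | clifford2 q U hU next ih =>
    have h1 : normSq (applyOp q U ψ) = normSq ψ := normSq_applyOp q hU.1 ψ
    refine CZReaches.of_clifford2 (q := q) hU (ih (hψ.applyOp q hU) ?_ (hA.trans h1.symm))
    rwa [Ne, ← normSq_eq_zero, h1, normSq_eq_zero]

theorem isGraphState_smul (G : SimpleGraph (Fin n)) (c : ℂ) (hc : c ≠ 0) (ψ : State n) :
    IsGraphState G (c • ψ) ↔ IsGraphState G ψ := by
  simp only [IsGraphState, Matrix.mulVec_smul]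
  exact forall_congr' fun v => (smul_right_injective _ hc).eq_iff

/-! ### Preparation of graph states -/

/-- The vector `ψ` can be prepared from `|0⟩^{⊗ n}` by Clifford gates. -/
def IsPreparable (ψ : State n) : Prop :=
  normSq ψ = 1 ∧ ∀ B : Algorithm n n, ∃ A : Algorithm n n, ∀ P, A.prob P (zeroState n) = B.prob P ψ

theorem IsPreparable.cz {ψ : State n} (h : IsPreparable ψ) (q : Fin 2 ↪ Fin n) :
    IsPreparable (applyOp q cz ψ) := by
  refine ⟨by rw [normSq_applyOp q isClifford_cz.1, h.1], fun B => ?_⟩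
  exact h.2 (.clifford2 q QPrep.cz isClifford_cz B)

theorem exists_isPreparable_const (n : ℕ) : ∃ c : ℂ, IsPreparable fun _ : Bits n => c := by
  have h1 : (tensor fun _ : Fin n => exchange pauliX pauliZ) *ᵥ zeroState n =
      fun _ => ∏ _j : Fin n, ((√2 : ℝ) : ℂ)⁻¹ := by
    funext x
    simp only [zeroState, Matrix.mulVec_single_one, Matrix.col_apply, tensor, Matrix.of_apply]
    refine Finset.prod_congr rfl fun j _ => ?_
    generalize x j = b
    fin_cases b <;> simp [exchange, pauliX, pauliZ]
  refine ⟨∏ _j : Fin n, ((√2 : ℝ) : ℂ)⁻¹, ?_⟩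
  rw [← h1]
  refine ⟨?_, fun B => ?_⟩
  · rw [normSq_mulVec (isClifford_tensor fun _ => isLocalClifford_exchangeXZ).1, normSq_zeroState]
  · obtain ⟨A, -, -, h⟩ := B.exists_local fun _ => isLocalClifford_exchangeXZ
    exact ⟨A, fun P => h P _⟩

theorem applyOp_cz {m : ℕ} (q : Fin 2 ↪ Fin m) (ψ : State m) (x : Bits m) :
    applyOp q cz ψ x = (if x (q 0) = 1 ∧ x (q 1) = 1 then -1 else 1) * ψ x := by
  rw [applyOp, Finset.sum_eq_single (x ∘ q)]
  · rw [cz, Matrix.diagonal_apply_eq]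
    congr 2
    funext j
    by_cases hj : ∃ a, q a = j
    · obtain ⟨a, rfl⟩ := hj
      exact q.injective.extend_apply _ _ a
    · exact Function.extend_apply' _ _ _ hj
  · intro y _ hy
    rw [cz, Matrix.diagonal_apply_ne _ hy.symm, zero_mul]
  · simp

/-- The phase that CZ gates on the pairs `s` give to the basis vector `x`. -/
def czPhase (s : Finset (Fin n × Fin n)) (x : Bits n) : ℂ :=
  ∏ p ∈ s, if x p.1 = 1 ∧ x p.2 = 1 then -1 else 1

theorem exists_isPreparable_czPhase (s : Finset (Fin n × Fin n)) (hs : ∀ p ∈ s, p.1 ≠ p.2) :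
    ∃ c : ℂ, IsPreparable fun x => czPhase s x * c := by
  induction s using Finset.induction_on with
  | empty => simpa [czPhase] using exists_isPreparable_const n
  | insert a s ha ih =>
    obtain ⟨c, hc⟩ := ih fun p hp => hs p (Finset.mem_insert_of_mem hp)
    refine ⟨c, ?_⟩
    have hinj : Function.Injective ![a.1, a.2] := by
      have := hs a (Finset.mem_insert_self _ _)
      intro i j
      fin_cases i <;> fin_cases j <;> simp [this, this.symm]
    convert hc.cz ⟨![a.1, a.2], hinj⟩ using 1
    funext x
    rw [applyOp_cz, czPhase, Finset.prod_insert ha, mul_assoc]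
    rfl

/-- The sign `(-1) ^ b`. -/
def bitSign (b : Fin 2) : ℂ := if b = 1 then -1 else 1

open Classical in
/-- The edges of `G`, as ordered pairs. -/
def edgePairs (G : SimpleGraph (Fin n)) : Finset (Fin n × Fin n) :=
  Finset.univ.filter fun p => p.1 < p.2 ∧ G.Adj p.1 p.2

open Classical in
/-- The effect of a bit flip at `v` on `czPhase`. -/
theorem czPhase_update (G : SimpleGraph (Fin n)) (v : Fin n) (x : Bits n) :
    czPhase (edgePairs G) (Function.update x v (x v + 1)) =
      (∏ w, if G.Adj v w then bitSign (x w) else 1) * czPhase (edgePairs G) x := by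
  have h1 : ∀ p ∈ edgePairs G,
      (if Function.update x v (x v + 1) p.1 = 1 ∧ Function.update x v (x v + 1) p.2 = 1 then
        (-1 : ℂ) else 1) =
      ((if p.1 = v then bitSign (x p.2) else 1) * if p.2 = v then bitSign (x p.1) else 1) *
        if x p.1 = 1 ∧ x p.2 = 1 then -1 else 1 := by
    intro p hp
    have hne : p.1 ≠ p.2 := ((Finset.mem_filter.1 hp).2.1).ne
    have flip : ∀ b : Fin 2, b + 1 = 1 ↔ ¬ b = 1 := by decide
    by_cases e1 : p.1 = v
    · have e2 : p.2 ≠ v := fun e => hne (e1.trans e.symm)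
      rw [e1] at *
      simp only [Function.update_self, Function.update_of_ne e2, flip, bitSign, if_neg e2, if_true]
      by_cases h : x v = 1 <;> by_cases h' : x p.2 = 1 <;> simp [h, h']
    · by_cases e2 : p.2 = v
      · rw [e2] at *
        simp only [Function.update_self, Function.update_of_ne e1, flip, bitSign, if_neg e1, if_true]
        by_cases h : x v = 1 <;> by_cases h' : x p.1 = 1 <;> simp [h, h']
      · simp [e1, e2]
  rw [czPhase, Finset.prod_congr rfl h1, Finset.prod_mul_distrib, Finset.prod_mul_distrib]
  refine congrArg (· * czPhase (edgePairs G) x) ?_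
  have h2 : (∏ p ∈ edgePairs G, if p.1 = v then bitSign (x p.2) else 1) =
      ∏ w, if v < w ∧ G.Adj v w then bitSign (x w) else 1 := by
    rw [edgePairs, Finset.prod_filter, Fintype.prod_prod_type, Finset.prod_eq_single v]
    · simp
    · intro u _ hu
      simp [hu]
    · simp
  have h3 : (∏ p ∈ edgePairs G, if p.2 = v then bitSign (x p.1) else 1) =
      ∏ w, if w < v ∧ G.Adj v w then bitSign (x w) else 1 := by
    rw [edgePairs, Finset.prod_filter, Fintype.prod_prod_type_right, Finset.prod_eq_single v]
    · simp [G.adj_comm]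
    · intro u _ hu
      simp [hu]
    · simp
  rw [h2, h3, ← Finset.prod_mul_distrib]
  refine Finset.prod_congr rfl fun w _ => ?_
  by_cases hw : G.Adj v w
  · rcases lt_or_gt_of_ne hw.ne with h | h <;> simp [hw, h, h.not_gt]
  · simp [hw]

open Classical in
theorem graphStabilizer_mulVec (G : SimpleGraph (Fin n)) (v : Fin n) (ψ : State n) (x : Bits n) :
    (graphStabilizer G v *ᵥ ψ) x =
      (∏ w, if G.Adj v w then bitSign (x w) else 1) * ψ (Function.update x v (x v + 1)) := by
  have flip : ∀ a b : Fin 2, pauliX a b = if b = a + 1 then 1 else 0 := by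
    intro a b
    fin_cases a <;> fin_cases b <;> simp [pauliX]
  have diag : ∀ a b : Fin 2, pauliZ a b = if b = a then bitSign a else 0 := by
    intro a b
    fin_cases a <;> fin_cases b <;> simp [pauliZ, bitSign]
  rw [Matrix.mulVec, dotProduct, Finset.sum_eq_single (Function.update x v (x v + 1))]
  · rw [graphStabilizer, tensor, Matrix.of_apply]
    refine congrArg (· * ψ (Function.update x v (x v + 1))) ?_
    refine Finset.prod_congr rfl fun w _ => ?_
    by_cases hw : w = v
    · subst hw
      simp [flip]
    · simp only [if_neg hw, Function.update_of_ne hw]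
      split_ifs
      · simp [diag]
      · simp
  · intro y _ hy
    obtain ⟨w, hw⟩ := Function.ne_iff.1 hy
    refine mul_eq_zero_of_left (Finset.prod_eq_zero (Finset.mem_univ w) ?_) _
    by_cases hwv : w = v
    · subst hwv
      rw [Function.update_self] at hw
      simp [flip, hw]
    · rw [Function.update_of_ne hwv] at hw
      simp only [if_neg hwv]
      split_ifs
      · simp [diag, hw]
      · exact Matrix.one_apply_ne hw.symm
  · simp

theorem exists_generates (G : SimpleGraph (Fin n)) : ∃ A : Algorithm n n, A.Generates G := by
  classical
  obtain ⟨c, h1, h2⟩ := exists_isPreparable_czPhase (edgePairs G)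
    fun p hp => ((Finset.mem_filter.1 hp).2.1).ne
  obtain ⟨A, hA⟩ := h2 .output
  refine ⟨A, ?_⟩
  have hG : IsGraphState G fun x => czPhase (edgePairs G) x * c := by
    intro v
    funext x
    have hsq : (∏ w, if G.Adj v w then bitSign (x w) else (1 : ℂ)) *
        (∏ w, if G.Adj v w then bitSign (x w) else 1) = 1 := by
      rw [← Finset.prod_mul_distrib]
      refine Finset.prod_eq_one fun w _ => ?_
      rw [bitSign]
      split_ifs <;> simp
    rw [graphStabilizer_mulVec, czPhase_update, mul_assoc, ← mul_assoc, hsq, one_mul]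
  rw [Algorithm.Generates, hA, Algorithm.prob, if_pos hG, h1]

end

end QPrep

theorem theorem1 (n : ℕ) (G : SimpleGraph (Fin n)) :
    ∃ (s : ℕ) (A : QPrep.Algorithm n (n + s)),
      A.Generates G ∧ A.OnlyCZ ∧ A.czComplexity = QPrep.graphCZComplexity G := by
  obtain ⟨s, A, hA, hcz⟩ : QPrep.graphCZComplexity G ∈
      {t | ∃ (s : ℕ) (A : QPrep.Algorithm n (n + s)), A.Generates G ∧ A.czComplexity = t} :=
    Nat.sInf_mem ((QPrep.exists_generates G).elim fun A hA => ⟨A.czComplexity, 0, A, hA, rfl⟩)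
  have hnorm := QPrep.normSq_zeroState (n + s)
  obtain ⟨σ, B, hB, hle, hprob⟩ := A.czReaches (QPrep.isGraphState_smul G)
    (QPrep.isStabilizer_zeroState (n + s)) (by
      rw [Ne, ← QPrep.normSq_eq_zero, hnorm]
      exact one_ne_zero) (hA.trans hnorm.symm)
  rw [QPrep.permState_zeroState, hnorm] at hprob
  exact ⟨s, B, hprob, hB, le_antisymm (hle.trans_eq hcz) (Nat.sInf_le ⟨s, B, hprob, rfl⟩)⟩
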